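/- Let $n\ge 1$ be an integer, let $0<\alpha<n$, and let $\mathbb R^n$ carry the Euclidean norm $|\cdot|$ and Lebesgue measure. Let $B^n$ be the closed unit ball and $\omega_n$ its volume. For a convex body $K\subset\mathbb R^n$ let \[I_{\alpha+1}(K)=\int |K\cap \ell|^{\alpha+1}\,d\ell\] be the integral over all lines $\ell\subset\mathbb R^n$ of the $(\alpha+1)$-st power of the length of $K\cap\ell$, with respect to the rigid motion invariant measure on lines, normalized so that $\int|K\cap\ell|\,d\ell$ is the volume of $K$; that is, \[I_{\alpha+1}(K)=\frac1{n\omega_n}\int_{\mathbb S^{n-1}}\int_{u^\perp}|K\cap(x+\mathbb Ru)|^{\alpha+1}\,dx\,du .\] Put \[\sigma_{n,\alpha}=\frac{n2^{\alpha}\pi^{\frac{n-\alpha-1}{2}}\,\Gamma(\frac{\alpha+1}{2})\,\Gamma(\frac n2+1)^{\frac\alpha n}}{\alpha\,\Gamma(\frac{n+\alpha}{2}+1)},\qquad \|f\|_{\frac n{n+\alpha}}=\Big(\int_{\mathbb R^n}|f(x)|^{\frac n{n+\alpha}}\,dx\Big)^{\frac{n+\alpha}n}.\] Then \[\sigma_{n,\alpha}=\frac{n\,I_{\alpha+1}(B^n)}{\alpha(\alpha+1)\,\omega_n^{\alpha/n}},\]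 and for every non-negative $f\in L^{n/(n+\alpha)}(\mathbb R^n)$ (that is, $f$ measurable with $\|f\|_{\frac n{n+\alpha}}<\infty$), \[\sigma_{n,\alpha}\,\|f\|_{\frac n{n+\alpha}}\ \ge\ \int_{\mathbb R^n}\int_{\mathbb R^n}\frac{\min\{f(x),f(y)\}}{|x-y|^{n-\alpha}}\,dx\,dy .\] Equality holds if and only if there are a constant $c\ge 0$ and a ball $B$ of positive radius with $f=c\,\chi_B$ almost everywhere. The constant is sharp: no constant smaller than $\sigma_{n,\alpha}$ can replace $\sigma_{n,\alpha}$ in the inequality for all such $f$. -/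

import Mathlib

open MeasureTheory
open scoped ENNReal

noncomputable section

/-- The chord power integral `I_q(K) = ∫ |K ∩ ℓ| ^ q dℓ` over all lines `ℓ` of `ℝⁿ`, with respect to
the rigid motion invariant measure on lines. A line is written as `x + ℝ u` with a unit vector `u`
and a point `x` of the hyperplane `uᗮ`; the measure is the uniform probability measure in `u` and
`(n - 1)`-dimensional Lebesgue measure in `x`, so that `I_1(K)` is the volume of `K`.
(The measure on `uᗮ` is spelled out as the Haar measure that gives mass one to the unit cube
of an orthonormal basis.) -/
def chordPowerIntegral (n : ℕ) (q : ℝ) (K : Set (EuclideanSpace ℝ (Fin n))) : ℝ≥0∞ :=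
  (∫⁻ u : Metric.sphere (0 : EuclideanSpace ℝ (Fin n)) 1,
      ∫⁻ x : (Submodule.span ℝ {(u : EuclideanSpace ℝ (Fin n))})ᗮ,
        (volume {t : ℝ | (x : EuclideanSpace ℝ (Fin n)) + t • (u : EuclideanSpace ℝ (Fin n)) ∈ K}) ^ q
      ∂(stdOrthonormalBasis ℝ
          (Submodule.span ℝ {(u : EuclideanSpace ℝ (Fin n))})ᗮ).toBasis.addHaar
    ∂(volume : Measure (EuclideanSpace ℝ (Fin n))).toSphere) /
  (volume : Measure (EuclideanSpace ℝ (Fin n))).toSphere Set.univ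

/-- The constant `σ_{n,α}`, in its explicit form. -/
def chordSobolevConst (n : ℕ) (α : ℝ) : ℝ :=
  n * 2 ^ α * Real.pi ^ ((n - α - 1) / 2) * Real.Gamma ((α + 1) / 2) *
      Real.Gamma ((n : ℝ) / 2 + 1) ^ (α / n) /
    (|α| * Real.Gamma ((n + α) / 2 + 1))

/-- The double integral `∫∫ min {f(x), f(y)} / |x - y|^(n - α) dx dy` of a non-negative function,
as an element of `[0, ∞]`. -/
def chordEnergy (n : ℕ) (α : ℝ) (f : EuclideanSpace ℝ (Fin n) → ℝ) : ℝ≥0∞ :=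
  ∫⁻ y, ∫⁻ x, ENNReal.ofReal (min (f x) (f y)) / ENNReal.ofReal ‖x - y‖ ^ ((n : ℝ) - α)

end

/-!
The minimum has the layer cake formula `min a b = ∫₀^∞ 1[t < a] 1[t < b] dt`. Hence the energy
`∫∫ min {f(x), f(y)} ‖x - y‖ ^ (α - n) dx dy` is the integral over `t` of the Riesz energies of the
level sets `{f > t}`. Two facts complete the argument: the Riesz inequality for sets, and an
inequality for the distribution function `t ↦ |{f > t}|` alone.

*Riesz inequality for sets.* Among the sets of given finite volume, balls have the largest Riesz
energy, and they are the only maximizers up to null sets. The proof uses polarization, which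
moves a set `A` across a hyperplane into a half-space wherever the mirror image leaves room. It
preserves the volume and increases the energy, because points on the same side of a mirror are
closer than points on different sides. If the half-space contains the center of a ball `B`, then
the part of `A \ B` whose mirror image lies in `B \ A` is moved into `B`, so `|A \ B|` decreases by
at least the volume of that part. Averaged over the hyperplanes that meet a bounded region, the
decrease is at least a fixed multiple of `|A \ B|` squared, since the images of one point under all
reflections are spread over space as in polar coordinates. Suitable polarizations therefore drive
`A` to `B`, and the energy of `A` is at most that of `B` (`rieszEnergy_le_closedBall`). For a
maximizer `A` every polarization must be trivial: on one of the two sides of each hyperplane, `A`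
contains the mirror image of its part on the other side, up to a null set. A hyperplane that bisects
`A` is then a hyperplane of symmetry, and composing `n` of them in orthogonal directions gives a
center of symmetry. If `A` were not the ball `B` around that center, some reflection would move part
of `A \ B` into `B \ A`; there would then be more of `A` on the far side of this mirror than on the
side of the center, which the symmetry excludes (`exists_ae_eq_closedBall_of_rieszEnergy_eq`).

*Distribution function.* The energy of a ball of volume `v` is a constant times
`v ^ ((n + α) / n)`, by scaling. For `q = (n + α) / n > 1`, Minkowski's inequality
`∫ |{f > t}| ^ q dt ≤ ‖f‖_{1/q}` (`lintegral_distribution_rpow_le`) completes the proof of the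
inequality; in the equality case `f` takes only one positive value, up to a null set, and is a
multiple of an indicator function
(`exists_ae_eq_indicator_of_lintegral_distribution_eq`).

*The constant.* Slicing the unit ball along the lines in each direction expresses both its
Riesz energy and its chord power integral through the integral of `(1 - ‖x‖ ^ 2) ^ b` over a unit
ball, which is found by multiplying with a Gamma integral and integrating a Gaussian
(`rieszEnergy_unitBall`, `chordPowerIntegral_unitBall`, `lintegral_rpow_one_sub_norm_sq`).
-/

noncomputable section

open Set Metric Filter Topology
open scoped RealInnerProductSpace Pointwise

variable {E : Type*} [NormedAddCommGroup E] [InnerProductSpace ℝ E]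

/-! ### Reflections in affine hyperplanes -/

/-- The reflection in the affine hyperplane `{x | ⟪u, x⟫ = s}`, for a unit vector `u`. An explicit
formula is used so that joint measurability in `(u, s, x)` is immediate. -/
def hyperplaneReflection (u : E) (s : ℝ) (x : E) : E := x - (2 * (⟪u, x⟫ - s)) • u

theorem inner_hyperplaneReflection {u : E} (hu : ‖u‖ = 1) (s : ℝ) (x : E) :
    ⟪u, hyperplaneReflection u s x⟫ = 2 * s - ⟪u, x⟫ := by
  simp only [hyperplaneReflection, inner_sub_right, inner_smul_right, real_inner_self_eq_norm_sq,
    hu]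
  ring

theorem hyperplaneReflection_involutive {u : E} (hu : ‖u‖ = 1) (s : ℝ) :
    Function.Involutive (hyperplaneReflection u s) := by
  intro x
  rw [hyperplaneReflection, inner_hyperplaneReflection hu, hyperplaneReflection, sub_sub,
    ← add_smul]
  ring_nf
  simp

theorem hyperplaneReflection_neg_neg (u : E) (s : ℝ) (x : E) :
    hyperplaneReflection (-u) (-s) x = hyperplaneReflection u s x := by
  simp only [hyperplaneReflection, inner_neg_left, smul_neg, ← neg_smul]
  ring_nf

theorem norm_sub_hyperplaneReflection_sq {u : E} (hu : ‖u‖ = 1) (s : ℝ) (x y : E) :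
    ‖x - hyperplaneReflection u s y‖ ^ 2
      = ‖x - y‖ ^ 2 + 4 * (s - ⟪u, x⟫) * (s - ⟪u, y⟫) := by
  have h : x - hyperplaneReflection u s y = (x - y) + (2 * (⟪u, y⟫ - s)) • u := by
    simp only [hyperplaneReflection]; abel
  rw [h, norm_add_sq_real, norm_smul, hu, inner_smul_right, inner_sub_left, mul_one,
    Real.norm_eq_abs, sq_abs, real_inner_comm u x, real_inner_comm u y]
  ring

theorem norm_hyperplaneReflection_sq {u : E} (hu : ‖u‖ = 1) (s : ℝ) (x : E) :
    ‖hyperplaneReflection u s x‖ ^ 2 = ‖x‖ ^ 2 + 4 * s * (s - ⟪u, x⟫) := by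
  have := norm_sub_hyperplaneReflection_sq hu s 0 x
  simpa using this

theorem hyperplaneReflection_eq {u : E} (hu : ‖u‖ = 1) (s : ℝ) (x : E) :
    hyperplaneReflection u s x = (ℝ ∙ u)ᗮ.reflection x + (2 * s) • u := by
  rw [Submodule.reflection_orthogonal_apply, Submodule.reflection_singleton_apply]
  simp only [hyperplaneReflection, hu]
  simp only [RCLike.ofReal_real_eq_id, id_eq, one_pow, div_one, two_smul, two_mul, sub_smul,
    add_smul]
  abel

theorem norm_hyperplaneReflection_sub {u : E} (hu : ‖u‖ = 1) (s : ℝ) (x y : E) :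
    ‖hyperplaneReflection u s x - hyperplaneReflection u s y‖ = ‖x - y‖ := by
  rw [hyperplaneReflection_eq hu, hyperplaneReflection_eq hu, add_sub_add_right_eq_sub, ← map_sub,
    LinearIsometryEquiv.norm_map]

theorem continuous_hyperplaneReflection (u : E) (s : ℝ) :
    Continuous (hyperplaneReflection u s) := by
  unfold hyperplaneReflection; fun_prop

theorem norm_sub_hyperplaneReflection_comm {u : E} (hu : ‖u‖ = 1) (s : ℝ) (x y : E) :
    ‖hyperplaneReflection u s x - y‖ = ‖x - hyperplaneReflection u s y‖ := by
  rw [← norm_hyperplaneReflection_sub hu s, hyperplaneReflection_involutive hu s x]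

variable [MeasurableSpace E] [BorelSpace E]

theorem measurable_hyperplaneReflection (u : E) (s : ℝ) :
    Measurable (hyperplaneReflection u s) := (continuous_hyperplaneReflection u s).measurable

variable [FiniteDimensional ℝ E]

theorem measurePreserving_hyperplaneReflection {u : E} (hu : ‖u‖ = 1) (s : ℝ) :
    MeasurePreserving (hyperplaneReflection u s) := by
  have : hyperplaneReflection u s = (· + (2 * s) • u) ∘ (ℝ ∙ u)ᗮ.reflection := by
    ext x; exact hyperplaneReflection_eq hu s x
  rw [this]
  exact (measurePreserving_add_right volume _).comp (LinearIsometryEquiv.measurePreserving _)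

theorem volume_hyperplane {u : E} (hu : ‖u‖ = 1) (s : ℝ) :
    volume {x : E | ⟪u, x⟫ = s} = 0 := by
  have hu0 : u ≠ 0 := by rintro rfl; simp at hu
  have h0 : volume ((ℝ ∙ u)ᗮ : Set E) = 0 := by
    apply Measure.addHaar_submodule
    intro h
    have : u ∈ (ℝ ∙ u)ᗮ := h ▸ Submodule.mem_top
    rw [Submodule.mem_orthogonal_singleton_iff_inner_right] at this
    exact hu0 (inner_self_eq_zero.mp this)
  have h1 : {x : E | ⟪u, x⟫ = s} = (· + (-s • u)) ⁻¹' ((ℝ ∙ u)ᗮ : Set E) := by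
    ext x
    simp only [mem_ofPred_eq, mem_preimage, SetLike.mem_coe,
      Submodule.mem_orthogonal_singleton_iff_inner_right, inner_add_right, inner_smul_right,
      real_inner_self_eq_norm_sq, hu]
    constructor <;> intro h <;> linarith
  rw [h1, measure_preimage_add_right, h0]

theorem measurableSet_halfSpace (u : E) (s : ℝ) : MeasurableSet {x : E | ⟪u, x⟫ < s} :=
  measurableSet_lt (by fun_prop) measurable_const

/-- An integral over the whole space, folded along a hyperplane onto one side of it. -/
theorem lintegral_eq_setLIntegral_halfSpace {u : E} (hu : ‖u‖ = 1) (s : ℝ) {h : E → ℝ≥0∞}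
    (hh : Measurable h) :
    ∫⁻ x, h x = ∫⁻ x in {x : E | ⟪u, x⟫ < s}, h x + h (hyperplaneReflection u s x) := by
  have hH := measurableSet_halfSpace u s
  rw [lintegral_add_left hh, ← lintegral_add_compl h hH]
  congr 1
  have hae : ({x : E | ⟪u, x⟫ < s}ᶜ : Set E) =ᵐ[volume] {x : E | s < ⟪u, x⟫} := by
    have := compl_mem_ae_iff.mpr (volume_hyperplane hu s)
    filter_upwards [this] with x hx
    apply propext
    change ¬ (⟪u, x⟫ < s) ↔ s < ⟪u, x⟫
    rw [not_lt]
    exact ⟨fun h => lt_of_le_of_ne h (Ne.symm hx), le_of_lt⟩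
  rw [setLIntegral_congr hae]
  have hpre : {x : E | ⟪u, x⟫ < s} = hyperplaneReflection u s ⁻¹' {x : E | s < ⟪u, x⟫} := by
    ext x
    simp only [mem_ofPred_eq, mem_preimage, inner_hyperplaneReflection hu]
    constructor <;> intro h <;> linarith
  rw [hpre]
  exact ((measurePreserving_hyperplaneReflection hu s).setLIntegral_comp_preimage
    (measurableSet_lt measurable_const (by fun_prop)) hh).symm

/-! ### Polar coordinates -/

theorem lintegral_eq_lintegral_sphere_Ioi [Nontrivial E] {h : E → ℝ≥0∞} (hh : Measurable h) :
    ∫⁻ x, h x = ∫⁻ u : sphere (0 : E) 1, (∫⁻ r in Ioi (0 : ℝ),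
      ENNReal.ofReal (r ^ (Module.finrank ℝ E - 1)) * h (r • (u : E)))
        ∂(volume : Measure E).toSphere := by
  have h1 : ∫⁻ x, h x = ∫⁻ x : ({(0 : E)}ᶜ : Set E), h (x : E) ∂(volume.comap Subtype.val) := by
    rw [lintegral_subtype_comap (measurableSet_singleton _).compl, restrict_compl_singleton]
  have h2 := (volume : Measure E).measurePreserving_homeomorphUnitSphereProd.lintegral_comp_emb
    (Homeomorph.measurableEmbedding _)
    (fun p : sphere (0 : E) 1 × Ioi (0 : ℝ) => h ((p.2 : ℝ) • (p.1 : E)))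
  have h3 : ∀ x : ({(0 : E)}ᶜ : Set E),
      h (((homeomorphUnitSphereProd E x).2 : ℝ) • ((homeomorphUnitSphereProd E x).1 : E))
        = h x := by
    intro x
    congr 1
    simpa using smul_inv_smul₀ (norm_ne_zero_iff.mpr x.2) (x : E)
  simp only [h3] at h2
  rw [h1, h2, lintegral_prod _ (by fun_prop)]
  refine lintegral_congr fun u => ?_
  rw [Measure.volumeIoiPow, lintegral_withDensity_eq_lintegral_mul _ (by fun_prop) (by fun_prop)]
  simp only [Pi.mul_apply]
  rw [lintegral_subtype_comap measurableSet_Ioi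
    (fun r : ℝ => ENNReal.ofReal (r ^ (Module.finrank ℝ E - 1)) * h (r • (u : E)))]

/-! ### The Riesz energy of a set -/

/-- The Riesz kernel `‖x - y‖ ^ (-β)`, with the value `∞` on the diagonal when `0 < β`. -/
def rieszKernel (β : ℝ) (x y : E) : ℝ≥0∞ := (‖x - y‖ₑ ^ β)⁻¹

/-- The Riesz energy `∫∫_{A × A} ‖x - y‖ ^ (-β)` of a set. -/
def rieszEnergy (β : ℝ) (A : Set E) : ℝ≥0∞ := ∫⁻ x in A, ∫⁻ y in A, rieszKernel β x y

omit [InnerProductSpace ℝ E] [MeasurableSpace E] [BorelSpace E] [FiniteDimensional ℝ E] in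
theorem rieszKernel_comm (β : ℝ) (x y : E) : rieszKernel β x y = rieszKernel β y x := by
  rw [rieszKernel, rieszKernel, ← enorm_neg, neg_sub]

@[fun_prop]
theorem measurable_rieszKernel {Ω : Type*} [MeasurableSpace Ω] {β : ℝ} {f g : Ω → E}
    (hf : Measurable f) (hg : Measurable g) :
    Measurable (fun ω => rieszKernel β (f ω) (g ω)) := by
  unfold rieszKernel; fun_prop

theorem rieszEnergy_congr {β : ℝ} {A B : Set E} (h : A =ᵐ[volume] B) :
    rieszEnergy β A = rieszEnergy β B := by
  rw [rieszEnergy, rieszEnergy, setLIntegral_congr h]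
  exact lintegral_congr fun x => setLIntegral_congr h

theorem rieszEnergy_mono {β : ℝ} {A B : Set E} (h : A ⊆ B) :
    rieszEnergy β A ≤ rieszEnergy β B :=
  (lintegral_mono fun _ => lintegral_mono_set h).trans (lintegral_mono_set h)

theorem rieszEnergy_eq_lintegral_indicator (β : ℝ) {A : Set E} (hA : MeasurableSet A) :
    rieszEnergy β A = ∫⁻ x, ∫⁻ y, A.indicator 1 x * (A.indicator 1 y * rieszKernel β x y) := by
  rw [rieszEnergy, ← lintegral_indicator hA]
  refine lintegral_congr fun x => ?_
  by_cases hx : x ∈ A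
  · simp only [hx, indicator_of_mem, Pi.one_apply, one_mul]
    rw [← lintegral_indicator hA]
    refine lintegral_congr fun y => ?_
    by_cases hy : y ∈ A <;> simp [hy]
  · simp [hx]

/-- The Riesz kernel is locally integrable when `β` is less than the dimension. -/
theorem lintegral_closedBall_rieszKernel_lt_top [Nontrivial E] {β : ℝ}
    (hβ : β < Module.finrank ℝ E) (R : ℝ) :
    ∫⁻ z in closedBall (0 : E) R, (‖z‖ₑ ^ β)⁻¹ < ∞ := by
  rw [← lintegral_indicator measurableSet_closedBall,
    lintegral_eq_lintegral_sphere_Ioi ((by fun_prop : Measurable fun z : E =>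
      (‖z‖ₑ ^ β)⁻¹).indicator measurableSet_closedBall)]
  have hd : 0 < Module.finrank ℝ E := Module.finrank_pos
  have key : ∀ u : sphere (0 : E) 1, (∫⁻ r in Ioi (0 : ℝ),
      ENNReal.ofReal (r ^ (Module.finrank ℝ E - 1)) *
        (closedBall (0 : E) R).indicator (fun z => (‖z‖ₑ ^ β)⁻¹) (r • (u : E)))
      = ∫⁻ r in Ioc 0 R, ENNReal.ofReal (r ^ ((Module.finrank ℝ E : ℝ) - 1 - β)) := by
    intro u
    rw [← lintegral_indicator measurableSet_Ioi, ← lintegral_indicator measurableSet_Ioc]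
    refine lintegral_congr fun r => ?_
    by_cases hr : 0 < r
    · have hn : ‖r • (u : E)‖ = r := by simp [norm_smul, abs_of_pos hr]
      by_cases hrR : r ≤ R
      · rw [indicator_of_mem (mem_Ioi.2 hr), indicator_of_mem (mem_Ioc.2 ⟨hr, hrR⟩),
          indicator_of_mem (by simpa [hn] using hrR), ← ofReal_norm, hn,
          ENNReal.ofReal_rpow_of_pos hr, ← ENNReal.ofReal_inv_of_pos (by positivity),
          ← ENNReal.ofReal_mul (by positivity), ← Real.rpow_neg hr.le,
          ← Real.rpow_natCast, ← Real.rpow_add hr, Nat.cast_pred hd]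
        ring_nf
      · rw [indicator_of_mem (mem_Ioi.2 hr),
          indicator_of_notMem (by rwa [mem_closedBall, dist_zero_right, hn]), mul_zero,
          indicator_of_notMem (fun h => hrR h.2)]
    · rw [indicator_of_notMem (by simpa using hr),
        indicator_of_notMem (by simp [hr])]
  simp only [key, lintegral_const]
  refine ENNReal.mul_lt_top ?_ (measure_lt_top _ _)
  have hint : IntervalIntegrable (fun r : ℝ => r ^ ((Module.finrank ℝ E : ℝ) - 1 - β))
      volume 0 R := intervalIntegral.intervalIntegrable_rpow' (by linarith)
  exact (lintegral_mono fun r => ENNReal.ofReal_le_ofReal (le_abs_self _)).trans_lt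
    (hint.1.hasFiniteIntegral.trans_le' (by simp [← Real.enorm_eq_ofReal_abs]))

/-- The potential of a set is bounded by a constant depending only on its volume. -/
theorem lintegral_rieszKernel_le {β : ℝ} (hβ : 0 < β) (A : Set E) (x : E) :
    ∫⁻ y in A, rieszKernel β x y ≤
      (∫⁻ z in closedBall (0 : E) 1, (‖z‖ₑ ^ β)⁻¹) + volume A := by
  have h1 : ∀ y, rieszKernel β x y ≤
      (closedBall (0 : E) 1).indicator (fun z => (‖z‖ₑ ^ β)⁻¹) (y - x) + 1 := by
    intro y
    rw [rieszKernel_comm, rieszKernel]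
    by_cases hy : y - x ∈ closedBall (0 : E) 1
    · rw [indicator_of_mem hy]
      exact le_self_add
    · rw [indicator_of_notMem hy, zero_add, ENNReal.inv_le_one]
      apply ENNReal.one_le_rpow _ hβ
      rw [← ofReal_norm, ENNReal.one_le_ofReal]
      simp only [mem_closedBall, dist_zero_right, not_le] at hy
      exact hy.le
  calc ∫⁻ y in A, rieszKernel β x y
      ≤ ∫⁻ y in A, ((closedBall (0 : E) 1).indicator (fun z => (‖z‖ₑ ^ β)⁻¹) (y - x) + 1) :=
        lintegral_mono h1
    _ = (∫⁻ y in A, (closedBall (0 : E) 1).indicator (fun z => (‖z‖ₑ ^ β)⁻¹) (y - x))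
        + volume A := by
        rw [lintegral_add_right _ measurable_const]; simp
    _ ≤ _ := by
        refine add_le_add_left ((setLIntegral_le_lintegral _ _).trans ?_) _
        rw [lintegral_sub_right_eq_self, lintegral_indicator measurableSet_closedBall]

theorem rieszEnergy_lt_top [Nontrivial E] {β : ℝ} (hβ : 0 < β) (hβd : β < Module.finrank ℝ E)
    {A : Set E} (hA : volume A < ∞) : rieszEnergy β A < ∞ := by
  refine (lintegral_mono fun x => lintegral_rieszKernel_le hβ A x).trans_lt ?_
  rw [lintegral_const]
  refine ENNReal.mul_lt_top (ENNReal.add_lt_top.2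
    ⟨lintegral_closedBall_rieszKernel_lt_top hβd 1, hA⟩) (by simpa using hA)

/-! ### Polarization -/

/-- The polarization of `A` with respect to the hyperplane `{x | ⟪u, x⟫ = s}`: for each pair of
points exchanged by the reflection of which exactly one lies in `A`, that point is moved to the side
`{x | ⟪u, x⟫ < s}`. -/
def polarization (u : E) (s : ℝ) (A : Set E) : Set E :=
  {x | (⟪u, x⟫ < s ∧ (x ∈ A ∨ hyperplaneReflection u s x ∈ A)) ∨
    (¬ ⟪u, x⟫ < s ∧ x ∈ A ∧ hyperplaneReflection u s x ∈ A)}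

theorem measurableSet_polarization (u : E) (s : ℝ) {A : Set E} (hA : MeasurableSet A) :
    MeasurableSet (polarization u s A) := by
  have hH := measurableSet_halfSpace u s
  have hσ := measurable_hyperplaneReflection u s hA
  exact (hH.inter (hA.union hσ)).union (hH.compl.inter (hA.inter hσ))

omit [MeasurableSpace E] [BorelSpace E] [FiniteDimensional ℝ E] in
theorem mem_polarization {u : E} {s : ℝ} {A : Set E} {x : E} (hx : ⟪u, x⟫ < s) :
    x ∈ polarization u s A ↔ x ∈ A ∨ hyperplaneReflection u s x ∈ A := by
  simp [polarization, hx]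

omit [MeasurableSpace E] [BorelSpace E] [FiniteDimensional ℝ E] in
theorem hyperplaneReflection_mem_polarization {u : E} (hu : ‖u‖ = 1) {s : ℝ} {A : Set E} {x : E}
    (hx : ⟪u, x⟫ < s) :
    hyperplaneReflection u s x ∈ polarization u s A ↔
      x ∈ A ∧ hyperplaneReflection u s x ∈ A := by
  have : s ≤ ⟪u, hyperplaneReflection u s x⟫ := by
    rw [inner_hyperplaneReflection hu]; linarith
  simp [polarization, this, this.not_gt, hyperplaneReflection_involutive hu s x, and_comm]

/-- The integrand of the Riesz energy of `A`, folded onto one side of a hyperplane in both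
variables. -/
def foldedEnergyIntegrand (β : ℝ) (u : E) (s : ℝ) (A : Set E) (x y : E) : ℝ≥0∞ :=
  (A.indicator 1 x * A.indicator 1 y +
      A.indicator 1 (hyperplaneReflection u s x) * A.indicator 1 (hyperplaneReflection u s y))
      * rieszKernel β x y +
    (A.indicator 1 x * A.indicator 1 (hyperplaneReflection u s y) +
      A.indicator 1 (hyperplaneReflection u s x) * A.indicator 1 y)
      * rieszKernel β x (hyperplaneReflection u s y)

theorem measurable_foldedEnergyIntegrand (β : ℝ) (u : E) (s : ℝ) {A : Set E}
    (hA : MeasurableSet A) :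
    Measurable (fun p : E × E => foldedEnergyIntegrand β u s A p.1 p.2) := by
  have h1 : Measurable (A.indicator (1 : E → ℝ≥0∞)) := measurable_one.indicator hA
  have h2 := measurable_hyperplaneReflection u s
  unfold foldedEnergyIntegrand
  fun_prop

theorem rieszEnergy_eq_lintegral_folded (β : ℝ) {u : E} (hu : ‖u‖ = 1) (s : ℝ) {A : Set E}
    (hA : MeasurableSet A) :
    rieszEnergy β A = ∫⁻ p, foldedEnergyIntegrand β u s A p.1 p.2
      ∂((volume.restrict {x : E | ⟪u, x⟫ < s}).prod (volume.restrict {x : E | ⟪u, x⟫ < s})) := by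
  have h1 : Measurable (A.indicator (1 : E → ℝ≥0∞)) := measurable_one.indicator hA
  have h2 := measurable_hyperplaneReflection u s
  rw [lintegral_prod _ (measurable_foldedEnergyIntegrand β u s hA).aemeasurable,
    rieszEnergy_eq_lintegral_indicator β hA,
    lintegral_eq_setLIntegral_halfSpace hu s (Measurable.lintegral_prod_right'
      (f := fun p : E × E =>
      A.indicator 1 p.1 * (A.indicator 1 p.2 * rieszKernel β p.1 p.2)) (by fun_prop))]
  refine lintegral_congr fun x => ?_
  rw [lintegral_eq_setLIntegral_halfSpace hu s (by fun_prop),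
    lintegral_eq_setLIntegral_halfSpace hu s (by fun_prop), ← lintegral_add_left (by fun_prop)]
  refine lintegral_congr fun y => ?_
  have h3 : rieszKernel β (hyperplaneReflection u s x) (hyperplaneReflection u s y)
      = rieszKernel β x y := by
    rw [rieszKernel, rieszKernel, ← ofReal_norm, norm_hyperplaneReflection_sub hu, ofReal_norm]
  have h4 : rieszKernel β (hyperplaneReflection u s x) y
      = rieszKernel β x (hyperplaneReflection u s y) := by
    rw [rieszKernel, rieszKernel, ← ofReal_norm, norm_sub_hyperplaneReflection_comm hu,
      ofReal_norm]
  rw [h3, h4, foldedEnergyIntegrand]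
  ring

omit [MeasurableSpace E] [BorelSpace E] [FiniteDimensional ℝ E] in
theorem rieszKernel_hyperplaneReflection_lt {β : ℝ} (hβ : 0 < β) {u : E} (hu : ‖u‖ = 1) {s : ℝ}
    {x y : E} (hx : ⟪u, x⟫ < s) (hy : ⟪u, y⟫ < s) :
    rieszKernel β x (hyperplaneReflection u s y) < rieszKernel β x y := by
  rw [rieszKernel, rieszKernel, ENNReal.inv_lt_inv]
  apply ENNReal.rpow_lt_rpow _ hβ
  rw [← ofReal_norm, ← ofReal_norm]
  have h := norm_sub_hyperplaneReflection_sq hu s x y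
  have h5 : 0 < (s - ⟪u, x⟫) * (s - ⟪u, y⟫) := mul_pos (by linarith) (by linarith)
  have h6 : ‖x - y‖ < ‖x - hyperplaneReflection u s y‖ :=
    lt_of_pow_lt_pow_left₀ 2 (norm_nonneg _) (by nlinarith)
  exact (ENNReal.ofReal_lt_ofReal_iff ((norm_nonneg _).trans_lt h6)).2 h6

omit [MeasurableSpace E] [BorelSpace E] [FiniteDimensional ℝ E] in
/-- The number of pairs in `A` among the four pairs formed by `x`, `y` and their mirror images does
not change, while pairs on different sides of the mirror can only be replaced by pairs on the same
side, for which the kernel is larger. -/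
theorem foldedEnergyIntegrand_le_polarization {β : ℝ} (hβ : 0 < β) {u : E} (hu : ‖u‖ = 1) {s : ℝ}
    (A : Set E) {x y : E} (hx : ⟪u, x⟫ < s) (hy : ⟪u, y⟫ < s) :
    foldedEnergyIntegrand β u s A x y ≤ foldedEnergyIntegrand β u s (polarization u s A) x y := by
  classical
  have hk := (rieszKernel_hyperplaneReflection_lt hβ hu hx hy).le
  simp only [foldedEnergyIntegrand, indicator_apply, mem_polarization hx, mem_polarization hy,
    hyperplaneReflection_mem_polarization hu hx, hyperplaneReflection_mem_polarization hu hy]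
  by_cases h1 : x ∈ A <;> by_cases h2 : hyperplaneReflection u s x ∈ A <;>
    by_cases h3 : y ∈ A <;> by_cases h4 : hyperplaneReflection u s y ∈ A <;>
    simp [h1, h2, h3, h4, hk, add_comm]

theorem rieszEnergy_le_polarization {β : ℝ} (hβ : 0 < β) {u : E} (hu : ‖u‖ = 1) (s : ℝ)
    {A : Set E} (hA : MeasurableSet A) :
    rieszEnergy β A ≤ rieszEnergy β (polarization u s A) := by
  rw [rieszEnergy_eq_lintegral_folded β hu s hA,
    rieszEnergy_eq_lintegral_folded β hu s (measurableSet_polarization u s hA),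
    Measure.prod_restrict]
  have hH := measurableSet_halfSpace u s
  exact setLIntegral_mono' (hH.prod hH) fun p hp =>
    foldedEnergyIntegrand_le_polarization hβ hu A hp.1 hp.2

/-- Polarization strictly increases the Riesz energy unless, up to null sets, it leaves the set
unchanged or replaces it with its mirror image. The first set in the hypotheses consists of points
of `A` that stay where they are, the second one of the new positions of the points that are moved;
these come closer to the former. -/
theorem rieszEnergy_lt_polarization {β : ℝ} (hβ : 0 < β) {u : E} (hu : ‖u‖ = 1) (s : ℝ)
    {A : Set E} (hA : MeasurableSet A) (hfin : rieszEnergy β A < ∞)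
    (h1 : volume {x | ⟪u, x⟫ < s ∧ x ∈ A ∧ hyperplaneReflection u s x ∉ A} ≠ 0)
    (h2 : volume {x | ⟪u, x⟫ < s ∧ x ∉ A ∧ hyperplaneReflection u s x ∈ A} ≠ 0) :
    rieszEnergy β A < rieszEnergy β (polarization u s A) := by
  classical
  have hH := measurableSet_halfSpace u s
  have hP := measurableSet_polarization u s hA
  rw [rieszEnergy_eq_lintegral_folded β hu s hA] at hfin ⊢
  rw [rieszEnergy_eq_lintegral_folded β hu s hP]
  rw [Measure.prod_restrict] at hfin ⊢
  refine lintegral_strict_mono_of_ae_le_of_ae_lt_on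
    (measurable_foldedEnergyIntegrand β u s hP).aemeasurable hfin.ne
    ((ae_restrict_iff' (hH.prod hH)).2 (.of_forall fun p hp =>
      foldedEnergyIntegrand_le_polarization hβ hu A hp.1 hp.2))
    (s := {x | ⟪u, x⟫ < s ∧ x ∈ A ∧ hyperplaneReflection u s x ∉ A} ×ˢ
      {x | ⟪u, x⟫ < s ∧ x ∉ A ∧ hyperplaneReflection u s x ∈ A}) ?_ ?_
  · rw [Measure.restrict_apply' (hH.prod hH), inter_eq_self_of_subset_left
      (prod_mono (fun x hx => hx.1) (fun x hx => hx.1)), Measure.prod_prod]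
    exact mul_ne_zero h1 h2
  · refine .of_forall fun p hp => ?_
    obtain ⟨⟨hx, hxA, hxσ⟩, hy, hyA, hyσ⟩ := hp
    have hk := rieszKernel_hyperplaneReflection_lt hβ hu hx hy
    simpa [foldedEnergyIntegrand, indicator_apply, mem_polarization hx, mem_polarization hy,
      hyperplaneReflection_mem_polarization hu hx, hyperplaneReflection_mem_polarization hu hy,
      hxA, hxσ, hyA, hyσ] using hk

theorem volume_eq_lintegral_halfSpace {u : E} (hu : ‖u‖ = 1) (s : ℝ) {A : Set E}
    (hA : MeasurableSet A) :
    volume A = ∫⁻ x in {x : E | ⟪u, x⟫ < s},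
      A.indicator 1 x + A.indicator 1 (hyperplaneReflection u s x) := by
  rw [← lintegral_indicator_one hA,
    lintegral_eq_setLIntegral_halfSpace hu s (measurable_one.indicator hA)]

theorem volume_polarization {u : E} (hu : ‖u‖ = 1) (s : ℝ) {A : Set E} (hA : MeasurableSet A) :
    volume (polarization u s A) = volume A := by
  classical
  rw [volume_eq_lintegral_halfSpace hu s hA,
    volume_eq_lintegral_halfSpace hu s (measurableSet_polarization u s hA)]
  refine setLIntegral_congr_fun (measurableSet_halfSpace u s) fun x hx => ?_
  simp only [indicator_apply, mem_polarization hx, hyperplaneReflection_mem_polarization hu hx]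
  by_cases h1 : x ∈ A <;> by_cases h2 : hyperplaneReflection u s x ∈ A <;> simp [h1, h2]

/-! ### Averaging over all reflections -/

theorem lintegral_comp_add_two_mul {g : ℝ → ℝ≥0∞} (hg : Measurable g) (a : ℝ) :
    2 * ∫⁻ s, g (2 * s - a) = ∫⁻ t, g t := by
  have h1 : ∫⁻ s, g (2 * s - a) = ∫⁻ t, g (t - a) ∂(volume.map (2 * ·)) := by
    rw [lintegral_map (by fun_prop) (by fun_prop)]
  rw [h1, Real.map_volume_mul_left two_ne_zero, lintegral_smul_measure,
    lintegral_sub_right_eq_self g a, smul_eq_mul, ← mul_assoc, abs_of_pos (by norm_num),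
    ENNReal.ofReal_inv_of_pos two_pos, ENNReal.ofReal_ofNat,
    ENNReal.mul_inv_cancel (by norm_num) (by norm_num), one_mul]

/-- The images of a point `x` under all reflections cover a bounded set `Q` at least as much as a
fixed multiple of the volume: integrating in `s` moves the image along the whole line through `x`
in direction `u`, so that this is polar coordinates around `x`. -/
theorem volume_le_lintegral_reflection [Nontrivial E] {R : ℝ} {Q : Set E}
    (hQ : MeasurableSet Q) (hQR : Q ⊆ closedBall 0 R) {x : E} (hx : x ∈ closedBall (0 : E) R) :
    volume Q ≤ ENNReal.ofReal ((2 * R) ^ (Module.finrank ℝ E - 1)) * 2 *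
      ∫⁻ u : sphere (0 : E) 1, (∫⁻ s : ℝ, Q.indicator 1 (hyperplaneReflection (u : E) s x))
        ∂(volume : Measure E).toSphere := by
  have h1 : Measurable (Q.indicator (1 : E → ℝ≥0∞)) := measurable_one.indicator hQ
  have h2 : ∀ u : sphere (0 : E) 1,
      2 * ∫⁻ s : ℝ, Q.indicator (1 : E → ℝ≥0∞) (hyperplaneReflection (u : E) s x)
        = ∫⁻ t : ℝ, Q.indicator 1 (t • (u : E) + x) := by
    intro u
    rw [← lintegral_comp_add_two_mul (g := fun t : ℝ => Q.indicator 1 (t • (u : E) + x))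
      (by fun_prop) (2 * ⟪(u : E), x⟫)]
    congr 1
    refine lintegral_congr fun s => ?_
    congr 1
    rw [hyperplaneReflection, sub_eq_neg_add, ← neg_smul]
    ring_nf
  rw [mul_assoc, ← lintegral_const_mul _ (Measurable.lintegral_prod_right'
    (f := fun p : sphere (0 : E) 1 × ℝ => Q.indicator (1 : E → ℝ≥0∞)
      (hyperplaneReflection (p.1 : E) p.2 x)) (by unfold hyperplaneReflection; fun_prop))]
  simp only [h2]
  rw [← lintegral_const_mul' _ _ ENNReal.ofReal_ne_top, ← lintegral_indicator_one hQ,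
    ← lintegral_add_right_eq_self _ x, lintegral_eq_lintegral_sphere_Ioi (by fun_prop)]
  refine lintegral_mono fun u => ?_
  rw [← lintegral_const_mul' _ _ ENNReal.ofReal_ne_top]
  refine (setLIntegral_mono' measurableSet_Ioi fun t ht => ?_).trans (setLIntegral_le_lintegral _ _)
  by_cases hm : t • (u : E) + x ∈ Q
  · gcongr
    · exact (mem_Ioi.1 ht).le
    · have h3 := hQR hm
      rw [mem_closedBall, dist_zero_right] at h3 hx
      have h4 : ‖t • (u : E)‖ ≤ 2 * R := by
        have := norm_sub_le (t • (u : E) + x) x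
        rw [add_sub_cancel_right] at this
        linarith
      simpa [norm_smul, abs_of_pos (mem_Ioi.1 ht)] using h4
  · simp [hm]

/-- If a bounded set `P` meets the mirror image of a bounded set `Q` in volume at most `η` for every
hyperplane, then `|P| |Q|` is bounded by a multiple of `η`. -/
theorem exists_volume_mul_volume_le [Nontrivial E] (R : ℝ) :
    ∃ C : ℝ≥0∞, C ≠ ∞ ∧ ∀ P Q : Set E, MeasurableSet P → MeasurableSet Q →
      P ⊆ closedBall 0 R → Q ⊆ closedBall 0 R → ∀ η : ℝ≥0∞,
      (∀ (u : E) (s : ℝ), ‖u‖ = 1 → volume (P ∩ hyperplaneReflection u s ⁻¹' Q) ≤ η) →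
      volume P * volume Q ≤ C * η := by
  refine ⟨ENNReal.ofReal ((2 * R) ^ (Module.finrank ℝ E - 1)) * 2 *
    (ENNReal.ofReal (2 * R) * (volume : Measure E).toSphere univ), by finiteness, ?_⟩
  intro P Q hP hQ hPR hQR η hη
  have h1 : Measurable (Q.indicator (1 : E → ℝ≥0∞)) := measurable_one.indicator hQ
  have hm : Measurable (fun p : (E × sphere (0 : E) 1) × ℝ => Q.indicator (1 : E → ℝ≥0∞)
      (hyperplaneReflection (p.1.2 : E) p.2 p.1.1)) := by
    unfold hyperplaneReflection; fun_prop
  set c := ENNReal.ofReal ((2 * R) ^ (Module.finrank ℝ E - 1)) * 2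
  have hc : c ≠ ∞ := by finiteness
  calc volume P * volume Q = ∫⁻ _ in P, volume Q := by
        rw [setLIntegral_const, mul_comm]
    _ ≤ ∫⁻ x in P, c * ∫⁻ u : sphere (0 : E) 1,
          (∫⁻ s : ℝ, Q.indicator 1 (hyperplaneReflection (u : E) s x))
          ∂(volume : Measure E).toSphere :=
        setLIntegral_mono' hP fun x hx => volume_le_lintegral_reflection hQ hQR (hPR hx)
    _ = c * ∫⁻ u : sphere (0 : E) 1, (∫⁻ s : ℝ, ∫⁻ x in P,
          Q.indicator 1 (hyperplaneReflection (u : E) s x))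
          ∂(volume : Measure E).toSphere := by
        rw [lintegral_const_mul' _ _ hc, lintegral_lintegral_swap]
        · congr 1
          refine lintegral_congr fun u => ?_
          rw [lintegral_lintegral_swap]
          exact (hm.comp (f := fun p : E × ℝ => ((p.1, u), p.2)) (by fun_prop)).aemeasurable
        · exact hm.lintegral_prod_right'.aemeasurable
    _ ≤ c * ∫⁻ u : sphere (0 : E) 1, (∫⁻ s in Icc (-R) R, η)
          ∂(volume : Measure E).toSphere := by
        refine mul_le_mul' le_rfl (lintegral_mono fun u => ?_)
        have hu : ‖(u : E)‖ = 1 := norm_eq_of_mem_sphere u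
        rw [← lintegral_indicator measurableSet_Icc]
        refine lintegral_mono fun s => ?_
        have hval : ∫⁻ x in P, Q.indicator (1 : E → ℝ≥0∞) (hyperplaneReflection (u : E) s x)
            = volume (P ∩ hyperplaneReflection (u : E) s ⁻¹' Q) := by
          have hpre := measurable_hyperplaneReflection (u : E) s hQ
          rw [inter_comm, ← Measure.restrict_apply hpre, ← lintegral_indicator_one hpre]
          rfl
        rw [hval]
        by_cases hs : s ∈ Icc (-R) R
        · rw [indicator_of_mem hs]
          exact hη u s hu
        · have hempty : P ∩ hyperplaneReflection (u : E) s ⁻¹' Q = ∅ := by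
            rw [eq_empty_iff_forall_notMem]
            rintro x ⟨hxP, hxQ⟩
            apply hs
            have h3 := hPR hxP
            have h4 := hQR hxQ
            rw [mem_closedBall, dist_zero_right] at h3 h4
            have h5 := inner_hyperplaneReflection hu s x
            have h6 := abs_le.1 (abs_real_inner_le_norm (u : E) x)
            have h7 := abs_le.1 (abs_real_inner_le_norm (u : E) (hyperplaneReflection (u : E) s x))
            rw [hu, one_mul] at h6 h7
            constructor <;> linarith [h6.1, h6.2, h7.1, h7.2]
          simp [hempty]
    _ = c * (ENNReal.ofReal (2 * R) * (volume : Measure E).toSphere univ) * η := by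
        simp only [lintegral_const, Measure.restrict_apply_univ, Real.volume_Icc]
        rw [show R - -R = 2 * R by ring]
        ring

/-! ### The Riesz inequality for balls -/

omit [MeasurableSpace E] [BorelSpace E] [FiniteDimensional ℝ E] in
theorem norm_le_norm_hyperplaneReflection {u : E} (hu : ‖u‖ = 1) {s : ℝ} (hs : 0 ≤ s) {x : E}
    (hx : ⟪u, x⟫ < s) : ‖x‖ ≤ ‖hyperplaneReflection u s x‖ := by
  refine le_of_sq_le_sq ?_ (norm_nonneg _)
  rw [norm_hyperplaneReflection_sq hu]
  nlinarith [mul_nonneg hs (sub_pos.2 hx).le]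

omit [MeasurableSpace E] [BorelSpace E] [FiniteDimensional ℝ E] in
theorem polarization_subset_closedBall {u : E} (hu : ‖u‖ = 1) {s : ℝ} (hs : 0 ≤ s) {A : Set E}
    {R : ℝ} (hA : A ⊆ closedBall 0 R) : polarization u s A ⊆ closedBall 0 R := by
  rintro x (⟨hx, hxA | hxA⟩ | ⟨-, hxA, -⟩)
  · exact hA hxA
  · have := hA hxA
    rw [mem_closedBall, dist_zero_right] at this ⊢
    exact (norm_le_norm_hyperplaneReflection hu hs hx).trans this
  · exact hA hxA

/-- Polarization towards the center of a ball moves into the ball every point of `A` outside the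
ball whose mirror image lies in the ball but not in `A`, and moves no point out of the ball. -/
theorem volume_polarization_sdiff_add_le {u : E} (hu : ‖u‖ = 1) {s : ℝ} (hs : 0 ≤ s) {A : Set E}
    (hA : MeasurableSet A) (r : ℝ) :
    volume (polarization u s A \ closedBall 0 r) +
      volume ((A \ closedBall 0 r) ∩ hyperplaneReflection u s ⁻¹' (closedBall 0 r \ A)) ≤
      volume (A \ closedBall 0 r) := by
  classical
  have hB : MeasurableSet (closedBall (0 : E) r) := measurableSet_closedBall
  have hP := (measurableSet_polarization u s hA).diff hB
  have hσ := measurable_hyperplaneReflection u s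
  have hm : Measurable ((polarization u s A \ closedBall 0 r).indicator (1 : E → ℝ≥0∞)) :=
    measurable_one.indicator hP
  rw [volume_eq_lintegral_halfSpace hu s (hA.diff hB), volume_eq_lintegral_halfSpace hu s hP,
    volume_eq_lintegral_halfSpace hu s ((hA.diff hB).inter (hσ (hB.diff hA))),
    ← lintegral_add_left (by fun_prop)]
  refine setLIntegral_mono' (measurableSet_halfSpace u s) fun x hx => ?_
  have hball : hyperplaneReflection u s x ∈ closedBall (0 : E) r → x ∈ closedBall (0 : E) r := by
    rw [mem_closedBall, mem_closedBall, dist_zero_right, dist_zero_right]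
    exact (norm_le_norm_hyperplaneReflection hu hs hx).trans
  simp only [indicator_apply, Set.mem_sdiff, mem_inter_iff, mem_preimage, mem_polarization hx,
    hyperplaneReflection_mem_polarization hu hx, hyperplaneReflection_involutive hu s x,
    Pi.one_apply]
  by_cases h1 : x ∈ A <;> by_cases h2 : hyperplaneReflection u s x ∈ A <;>
    by_cases h3 : x ∈ closedBall (0 : E) r <;>
    by_cases h4 : hyperplaneReflection u s x ∈ closedBall (0 : E) r <;>
    first
    | exact absurd (hball h4) h3
    | simp only [h1, h2, h3, h4]; simp

omit [MeasurableSpace E] [BorelSpace E] [FiniteDimensional ℝ E] in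
/-- A hyperplane through the center of a ball is no mirror that moves a point outside the ball into
the ball. -/
theorem ne_zero_of_hyperplaneReflection_mem_closedBall {u : E} (hu : ‖u‖ = 1) {s r : ℝ} {x : E}
    (hx : x ∉ closedBall (0 : E) r) (hσ : hyperplaneReflection u s x ∈ closedBall (0 : E) r) :
    s ≠ 0 := by
  rintro rfl
  rw [mem_closedBall, dist_zero_right] at hx hσ
  have h := norm_hyperplaneReflection_sq hu 0 x
  have : ‖hyperplaneReflection u 0 x‖ < ‖x‖ := lt_of_le_of_lt hσ (not_le.1 hx)
  nlinarith [norm_nonneg (hyperplaneReflection u 0 x)]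

/-- If `A` and a centered ball have differences of large volume, then some polarization towards the
center moves a large part of `A` into the ball. -/
theorem exists_reflection_lt_volume [Nontrivial E] (R : ℝ) :
    ∃ C : ℝ≥0∞, C ≠ ∞ ∧ ∀ (A : Set E) (r : ℝ) (P : Set E), MeasurableSet A → MeasurableSet P →
      P ⊆ A \ closedBall 0 r → P ⊆ closedBall 0 R → r ≤ R → ∀ η : ℝ≥0∞,
      C * η < volume P * volume (closedBall 0 r \ A) →
      ∃ (u : E) (s : ℝ), ‖u‖ = 1 ∧ 0 < s ∧
        η < volume (P ∩ hyperplaneReflection u s ⁻¹' (closedBall 0 r \ A)) := by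
  obtain ⟨C, hC, h⟩ := exists_volume_mul_volume_le (E := E) R
  refine ⟨C, hC, fun A r P hA hP hPA hPR hrR η hη => ?_⟩
  by_contra! hcon
  refine hη.not_ge (h P _ hP (measurableSet_closedBall.diff hA) hPR
    (sdiff_subset.trans (closedBall_subset_closedBall hrR)) η fun u s hu => ?_)
  by_contra! hlt
  obtain ⟨x, hxP, hxB⟩ := nonempty_of_measure_ne_zero (ne_bot_of_gt hlt)
  rcases lt_or_gt_of_ne
    (ne_zero_of_hyperplaneReflection_mem_closedBall hu (hPA hxP).2 hxB.1) with hs | hs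
  · refine (hcon (-u) (-s) (by rwa [norm_neg]) (by linarith)).not_gt ?_
    rwa [show hyperplaneReflection (-u) (-s) = hyperplaneReflection u s from
      funext (hyperplaneReflection_neg_neg u s)]
  · exact (hcon u s hu hs).not_gt hlt

/-- The Riesz energy depends continuously on the set, in the sense of volume. -/
theorem rieszEnergy_le_add {β : ℝ} (hβ : 0 < β) (A B : Set E) :
    rieszEnergy β A ≤ rieszEnergy β B +
      (2 * (∫⁻ z in closedBall (0 : E) 1, (‖z‖ₑ ^ β)⁻¹) + volume A + volume B)
        * volume (A \ B) := by
  set K := ∫⁻ z in closedBall (0 : E) 1, (‖z‖ₑ ^ β)⁻¹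
  have hsub : A ⊆ B ∪ (A \ B) := by rw [union_sdiff_self]; exact subset_union_right
  have h1 : ∀ f : E → ℝ≥0∞, ∫⁻ x in A, f x ≤ (∫⁻ x in B, f x) + ∫⁻ x in A \ B, f x := fun f =>
    (lintegral_mono_set hsub).trans (lintegral_union_le f B (A \ B))
  have hswap : ∫⁻ x in B, ∫⁻ y in A \ B, rieszKernel β x y
      = ∫⁻ x in A \ B, ∫⁻ y in B, rieszKernel β x y := by
    rw [lintegral_lintegral_swap (by fun_prop)]
    simp only [rieszKernel_comm]
  calc rieszEnergy β A
      ≤ (∫⁻ x in B, ∫⁻ y in A, rieszKernel β x y)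
        + ∫⁻ x in A \ B, ∫⁻ y in A, rieszKernel β x y := h1 _
    _ ≤ (∫⁻ x in B, (∫⁻ y in B, rieszKernel β x y) + ∫⁻ y in A \ B, rieszKernel β x y)
        + ∫⁻ x in A \ B, ∫⁻ y in A, rieszKernel β x y := by
        gcongr
        exact h1 _
    _ = rieszEnergy β B + ((∫⁻ x in A \ B, ∫⁻ y in B, rieszKernel β x y)
        + ∫⁻ x in A \ B, ∫⁻ y in A, rieszKernel β x y) := by
        rw [lintegral_add_left (by fun_prop), hswap, add_assoc]; rfl
    _ ≤ rieszEnergy β B + ((∫⁻ x in A \ B, (K + volume B))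
        + ∫⁻ x in A \ B, (K + volume A)) := by
        gcongr
        · exact lintegral_rieszKernel_le hβ _ _
        · exact lintegral_rieszKernel_le hβ _ _
    _ = _ := by
        simp only [lintegral_const, Measure.restrict_apply_univ]
        ring

/-- Among bounded sets of given volume, a ball has the largest Riesz energy. No limit set is needed:
if the infimum `δ` of `|A' \ B|` over the sets `A'` reachable from `A` were positive, then the
polarization of an almost optimal `A'` would decrease `|A' \ B|` below `δ`. -/
theorem rieszEnergy_le_closedBall_of_subset [Nontrivial E] {β : ℝ} (hβ : 0 < β)
    (hβd : β < Module.finrank ℝ E) {A : Set E} (hA : MeasurableSet A) {R r : ℝ}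
    (hAR : A ⊆ closedBall 0 R) (hr : volume A = volume (closedBall (0 : E) r)) :
    rieszEnergy β A ≤ rieszEnergy β (closedBall (0 : E) r) := by
  wlog hrR : r ≤ R generalizing R
  · exact this (hAR.trans (closedBall_subset_closedBall (not_le.1 hrR).le)) le_rfl
  have hB : MeasurableSet (closedBall (0 : E) r) := measurableSet_closedBall
  have hBfin : volume (closedBall (0 : E) r) ≠ ∞ := measure_closedBall_lt_top.ne
  -- the bounded sets reachable from `A` by operations that do not decrease the energy
  let S : Set (Set E) := {A' | MeasurableSet A' ∧ A' ⊆ closedBall 0 R ∧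
    volume A' = volume (closedBall (0 : E) r) ∧ rieszEnergy β A ≤ rieszEnergy β A'}
  have hAS : A ∈ S := ⟨hA, hAR, hr, le_rfl⟩
  have hinf : ⨅ A' ∈ S, volume (A' \ closedBall (0 : E) r) = 0 := by
    set δ := ⨅ A' ∈ S, volume (A' \ closedBall (0 : E) r) with hδ
    by_contra hne
    obtain ⟨C, hC, h⟩ := exists_reflection_lt_volume (E := E) R
    have hδle : ∀ A' ∈ S, δ ≤ volume (A' \ closedBall (0 : E) r) := fun A' h => iInf₂_le A' h
    have hδfin : δ ≠ ∞ := ((hδle A hAS).trans_lt ((measure_mono sdiff_subset).trans_lt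
      (hr ▸ hBfin.lt_top))).ne
    obtain ⟨η, hη0, hη⟩ : ∃ η : ℝ≥0∞, η ≠ 0 ∧ C * η < δ * δ := by
      obtain ⟨η, hη0, hη⟩ := ENNReal.exists_nnreal_pos_mul_lt hC (mul_ne_zero hne hne)
      exact ⟨η, by exact_mod_cast hη0.ne', by rwa [mul_comm]⟩
    obtain ⟨A', hA'S, hA'⟩ : ∃ A' ∈ S, volume (A' \ closedBall (0 : E) r) < δ + η := by
      have := ENNReal.lt_add_right hδfin hη0
      rw [hδ] at this
      simpa only [iInf_lt_iff, exists_prop] using this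
    obtain ⟨hm, hR, hv, hE⟩ := hA'S
    have hvB : volume (closedBall (0 : E) r \ A') = volume (A' \ closedBall (0 : E) r) :=
      measure_sdiff_symm hB.nullMeasurableSet hm.nullMeasurableSet hv.symm
        (measure_ne_top_of_subset inter_subset_left hBfin)
    obtain ⟨u, s, hu, hs, hlt⟩ := h A' r (A' \ closedBall 0 r) hm (hm.diff hB) subset_rfl
      (sdiff_subset.trans hR) hrR η (hη.trans_le (by
        rw [hvB]; exact mul_le_mul' (hδle A' ⟨hm, hR, hv, hE⟩) (hδle A' ⟨hm, hR, hv, hE⟩)))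
    have hS : polarization u s A' ∈ S := ⟨measurableSet_polarization u s hm,
      polarization_subset_closedBall hu hs.le hR, (volume_polarization hu s hm).trans hv,
      hE.trans (rieszEnergy_le_polarization hβ hu s hm)⟩
    have h1 := (add_le_add (hδle _ hS) hlt.le).trans
      (volume_polarization_sdiff_add_le hu hs.le hm r)
    exact h1.not_gt hA'
  set K := 2 * (∫⁻ z in closedBall (0 : E) 1, (‖z‖ₑ ^ β)⁻¹) + volume (closedBall (0 : E) r)
    + volume (closedBall (0 : E) r)
  have hK : K ≠ ∞ := by
    have := (lintegral_closedBall_rieszKernel_lt_top (E := E) hβd 1).ne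
    finiteness
  have hle : ∀ A' ∈ S, rieszEnergy β A ≤ rieszEnergy β (closedBall (0 : E) r) +
      K * volume (A' \ closedBall (0 : E) r) := by
    rintro A' ⟨hm, -, hv, hE⟩
    refine hE.trans ((rieszEnergy_le_add hβ A' (closedBall 0 r)).trans_eq ?_)
    rw [hv]
  have : rieszEnergy β A ≤ ⨅ A' : S, (rieszEnergy β (closedBall (0 : E) r) +
      K * volume ((A' : Set E) \ closedBall (0 : E) r)) := le_iInf fun A' => hle A' A'.2
  have hne : Nonempty S := ⟨⟨A, hAS⟩⟩
  rw [iInf_subtype'] at hinf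
  rwa [← ENNReal.add_iInf, ← ENNReal.mul_iInf fun h => absurd h hK, hinf, mul_zero,
    add_zero] at this

theorem exists_volume_closedBall_eq [Nontrivial E] {v : ℝ≥0∞} (hv : v ≠ ∞) :
    ∃ r : ℝ, 0 ≤ r ∧ volume (closedBall (0 : E) r) = v := by
  have hd : Module.finrank ℝ E ≠ 0 := Module.finrank_pos.ne'
  set ω := volume (closedBall (0 : E) 1)
  have hω : ω ≠ ∞ := measure_closedBall_lt_top.ne
  have hω0 : ω ≠ 0 := (measure_closedBall_pos _ _ one_pos).ne'
  refine ⟨((v / ω).toReal) ^ ((Module.finrank ℝ E : ℝ)⁻¹), by positivity, ?_⟩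
  have h := Measure.addHaar_closedBall_mul volume (0 : E)
    (r := ((v / ω).toReal) ^ ((Module.finrank ℝ E : ℝ)⁻¹)) (by positivity) zero_le_one
  rw [mul_one, Real.rpow_inv_natCast_pow ENNReal.toReal_nonneg hd,
    ENNReal.ofReal_toReal (ENNReal.div_ne_top hv hω0)] at h
  rw [h, ENNReal.div_mul_cancel hω0 hω]

/-- Among sets of given finite volume, a ball has the largest Riesz energy; unbounded sets are
exhausted by bounded ones. -/
theorem rieszEnergy_le_closedBall [Nontrivial E] {β : ℝ} (hβ : 0 < β)
    (hβd : β < Module.finrank ℝ E) {A : Set E} (hA : MeasurableSet A) {r : ℝ}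
    (hr : volume A = volume (closedBall (0 : E) r)) :
    rieszEnergy β A ≤ rieszEnergy β (closedBall (0 : E) r) := by
  have hcut : ∀ N : ℕ, rieszEnergy β (A ∩ closedBall 0 N) ≤
      rieszEnergy β (closedBall (0 : E) r) := by
    intro N
    have hle : volume (A ∩ closedBall 0 N) ≤ volume (closedBall (0 : E) r) :=
      (measure_mono inter_subset_left).trans_eq hr
    obtain ⟨t, -, ht⟩ := exists_volume_closedBall_eq (E := E)
      (hle.trans_lt measure_closedBall_lt_top).ne
    refine (rieszEnergy_le_closedBall_of_subset hβ hβd (hA.inter measurableSet_closedBall)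
      inter_subset_right ht.symm).trans ?_
    rcases le_total t r with h | h
    · exact rieszEnergy_mono (closedBall_subset_closedBall h)
    · refine (rieszEnergy_congr (ae_eq_of_subset_of_measure_ge (closedBall_subset_closedBall h)
        (ht ▸ hle) measurableSet_closedBall.nullMeasurableSet
        measure_closedBall_lt_top.ne)).symm.le
  have hmono : Monotone fun N : ℕ => A ∩ closedBall (0 : E) N := fun i j hij =>
    inter_subset_inter_right _ (closedBall_subset_closedBall (Nat.cast_le.2 hij))
  have hprod : ∀ B : Set E, rieszEnergy β B =
      ∫⁻ p in B ×ˢ B, rieszKernel β p.1 p.2 ∂(volume.prod volume) := by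
    intro B
    rw [← Measure.prod_restrict, lintegral_prod _ (by fun_prop)]
    rfl
  have hun : A ×ˢ A = ⋃ N : ℕ, (A ∩ closedBall (0 : E) N) ×ˢ (A ∩ closedBall (0 : E) N) := by
    rw [iUnion_prod_of_monotone hmono hmono]
    have : ⋃ N : ℕ, A ∩ closedBall (0 : E) N = A := by
      rw [← inter_iUnion, iUnion_closedBall_nat, inter_univ]
    rw [this]
  rw [hprod A, hun, setLIntegral_iUnion_of_directed]
  · refine iSup_le fun N => ?_
    rw [← hprod]
    exact hcut N
  · exact (Monotone.directed_le fun i j hij => prod_mono (hmono hij) (hmono hij))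

/-! ### Sets of maximal Riesz energy are balls -/

theorem exists_measure_Iio_eq_measure_Ioi (ν : Measure ℝ) [IsFiniteMeasure ν]
    [NullSingletonClass ν] : ∃ s, ν (Iio s) = ν (Ioi s) := by
  have hcont : Continuous fun s => ν.real (Iic s) := by
    have h := intervalIntegral.continuous_primitive (μ := ν) (f := fun _ => (1 : ℝ))
      (fun a b => intervalIntegrable_const) 0
    have heq : (fun s => ν.real (Iic s)) =
        fun s => ν.real (Iic 0) + ∫ _ in (0 : ℝ)..s, (1 : ℝ) ∂ν := by
      ext s
      rw [← intervalIntegral.integral_Iic_sub_Iic (integrable_const _).integrableOn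
        (integrable_const _).integrableOn]
      simp
    rw [heq]
    exact continuous_const.add h
  have hcompl : ∀ s, ν.real (Iic s) + ν.real (Ioi s) = ν.real univ := by
    intro s
    rw [← compl_Iic, measureReal_add_measureReal_compl measurableSet_Iic]
  suffices h : ∃ s, ν.real (Iic s) = ν.real univ / 2 by
    obtain ⟨s, hs⟩ := h
    refine ⟨s, ?_⟩
    rw [measure_congr Iio_ae_eq_Iic]
    refine (ENNReal.toReal_eq_toReal_iff' (measure_ne_top _ _) (measure_ne_top _ _)).1 ?_
    have := hcompl s
    simp only [Measure.real] at *
    linarith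
  rcases eq_or_lt_of_le (measureReal_nonneg (μ := ν) (s := univ)) with h0 | hpos
  · refine ⟨0, le_antisymm ?_ ?_⟩
    · rw [← h0, zero_div, h0]
      exact measureReal_mono (subset_univ _)
    · rw [← h0, zero_div]
      exact measureReal_nonneg
  have htop : ∃ b, ν.real univ / 2 ≤ ν.real (Iic b) := by
    have h := (ENNReal.tendsto_toReal (measure_ne_top ν univ)).comp (tendsto_measure_Iic_atTop ν)
    exact (h.eventually (lt_mem_nhds (show ν.real univ / 2 < ν.real univ by linarith))).exists.imp
      fun b hb => le_of_lt hb
  have hbot : ∃ a, ν.real (Iic a) ≤ ν.real univ / 2 := by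
    have h := (ENNReal.tendsto_toReal (measure_ne_top ν univ)).comp (tendsto_measure_Ici_atBot ν)
    obtain ⟨a, ha⟩ :=
      (h.eventually (lt_mem_nhds (show ν.real univ / 2 < ν.real univ by linarith))).exists
    have ha' : ν.real univ / 2 < ν.real (Ici a) := ha
    refine ⟨a, ?_⟩
    have := hcompl a
    rw [measureReal_congr Ioi_ae_eq_Ici] at this
    linarith
  obtain ⟨a, ha⟩ := hbot
  obtain ⟨b, hb⟩ := htop
  exact mem_range_of_exists_le_of_exists_ge hcont ⟨a, ha⟩ ⟨b, hb⟩

/-- Every set of finite volume is bisected by a hyperplane of any given direction. -/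
theorem exists_bisecting_hyperplane {u : E} (hu : ‖u‖ = 1) {A : Set E} (hA : volume A ≠ ∞) :
    ∃ s, volume (A ∩ {x | ⟪u, x⟫ < s}) = volume (A ∩ {x | s < ⟪u, x⟫}) := by
  have hm : Measurable fun x : E => ⟪u, x⟫ := by fun_prop
  have : Fact (volume A < ∞) := ⟨hA.lt_top⟩
  have hatoms : NullSingletonClass ((volume.restrict A).map fun x : E => ⟪u, x⟫) := ⟨fun s => by
    rw [Measure.map_apply hm (measurableSet_singleton s)]
    exact measure_mono_null (fun x hx => hx) (Measure.absolutelyContinuous_of_le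
      Measure.restrict_le_self (volume_hyperplane hu s))⟩
  obtain ⟨s, hs⟩ := exists_measure_Iio_eq_measure_Ioi
    ((volume.restrict A).map fun x : E => ⟪u, x⟫)
  rw [Measure.map_apply hm measurableSet_Iio, Measure.map_apply hm measurableSet_Ioi,
    Measure.restrict_apply (hm measurableSet_Iio), Measure.restrict_apply (hm measurableSet_Ioi),
    inter_comm, inter_comm _ A] at hs
  exact ⟨s, hs⟩

theorem volume_inter_halfSpace (u : E) (s : ℝ) {A : Set E} (hA : MeasurableSet A) :
    volume (A ∩ {x | ⟪u, x⟫ < s}) =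
      volume {x | ⟪u, x⟫ < s ∧ x ∈ A ∧ hyperplaneReflection u s x ∈ A} +
      volume {x | ⟪u, x⟫ < s ∧ x ∈ A ∧ hyperplaneReflection u s x ∉ A} := by
  rw [← measure_inter_add_sdiff _ (measurable_hyperplaneReflection u s hA)]
  congr 2 <;> (ext x; simp only [mem_inter_iff, Set.mem_sdiff, mem_preimage, mem_ofPred_eq]; tauto)

theorem volume_inter_halfSpace_compl {u : E} (hu : ‖u‖ = 1) (s : ℝ) {A : Set E}
    (hA : MeasurableSet A) :
    volume (A ∩ {x | s < ⟪u, x⟫}) =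
      volume {x | ⟪u, x⟫ < s ∧ x ∈ A ∧ hyperplaneReflection u s x ∈ A} +
      volume {x | ⟪u, x⟫ < s ∧ x ∉ A ∧ hyperplaneReflection u s x ∈ A} := by
  have hK : MeasurableSet {x : E | s < ⟪u, x⟫} := measurableSet_lt measurable_const (by fun_prop)
  rw [← (measurePreserving_hyperplaneReflection hu s).measure_preimage
    (hA.inter hK).nullMeasurableSet, ← measure_inter_add_sdiff _ hA]
  have hiff : ∀ x, s < ⟪u, hyperplaneReflection u s x⟫ ↔ ⟪u, x⟫ < s := by
    intro x
    rw [inner_hyperplaneReflection hu]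
    constructor <;> intro h <;> linarith
  congr 2 <;> (
    ext x
    simp only [mem_inter_iff, Set.mem_sdiff, mem_preimage, mem_ofPred_eq, hiff]; tauto)

/-- If each polarization of `A` is trivial, then a hyperplane that bisects `A` is a hyperplane of
symmetry. -/
theorem ae_eq_preimage_hyperplaneReflection {u : E} (hu : ‖u‖ = 1) {s : ℝ} {A : Set E}
    (hA : MeasurableSet A) (hfin : volume A ≠ ∞)
    (hpol : volume {x | ⟪u, x⟫ < s ∧ x ∈ A ∧ hyperplaneReflection u s x ∉ A} = 0 ∨
      volume {x | ⟪u, x⟫ < s ∧ x ∉ A ∧ hyperplaneReflection u s x ∈ A} = 0)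
    (hs : volume (A ∩ {x | ⟪u, x⟫ < s}) = volume (A ∩ {x | s < ⟪u, x⟫})) :
    (hyperplaneReflection u s ⁻¹' A : Set E) =ᵐ[volume] A := by
  classical
  rw [volume_inter_halfSpace u s hA, volume_inter_halfSpace_compl hu s hA,
    ENNReal.add_right_inj (measure_ne_top_of_subset (fun x hx => hx.2.1) hfin)] at hs
  have h12 : volume {x | ⟪u, x⟫ < s ∧ x ∈ A ∧ hyperplaneReflection u s x ∉ A} = 0 ∧
      volume {x | ⟪u, x⟫ < s ∧ x ∉ A ∧ hyperplaneReflection u s x ∈ A} = 0 := by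
    rcases hpol with h | h
    · exact ⟨h, hs ▸ h⟩
    · exact ⟨hs.trans h, h⟩
  have hσ := measurable_hyperplaneReflection u s hA
  have hD : ∀ B C : Set E, MeasurableSet B → MeasurableSet C →
      (∀ x, x ∈ B \ C ↔ x ∈ A ∧ hyperplaneReflection u s x ∉ A) ∨
      (∀ x, x ∈ B \ C ↔ x ∉ A ∧ hyperplaneReflection u s x ∈ A) → volume (B \ C) = 0 := by
    intro B C hB hC hBC
    rw [volume_eq_lintegral_halfSpace hu s (hB.diff hC)]
    refine (lintegral_congr_ae ?_).trans lintegral_zero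
    rw [EventuallyEq, ae_restrict_iff' (measurableSet_halfSpace u s)]
    filter_upwards [measure_eq_zero_iff_ae_notMem.1 h12.1, measure_eq_zero_iff_ae_notMem.1 h12.2]
      with x h1 h2 hx
    simp only [not_and, not_not] at h1 h2 hx
    have h1 := h1 hx
    have h2 := h2 hx
    rcases hBC with h | h <;>
    · simp only [indicator_apply, h, hyperplaneReflection_involutive hu s x]
      by_cases ha : x ∈ A <;> by_cases hb : hyperplaneReflection u s x ∈ A <;> simp_all
  rw [ae_eq_set]
  exact ⟨hD _ _ hσ hA (.inr fun x => and_comm), hD _ _ hA hσ (.inl fun x => Iff.rfl)⟩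

/-- If each polarization of `A` is trivial, then `A` is symmetric about some point. -/
theorem exists_ae_eq_preimage_pointReflection {A : Set E} (hA : MeasurableSet A)
    (hfin : volume A ≠ ∞)
    (hpol : ∀ (u : E) (s : ℝ), ‖u‖ = 1 →
      volume {x | ⟪u, x⟫ < s ∧ x ∈ A ∧ hyperplaneReflection u s x ∉ A} = 0 ∨
      volume {x | ⟪u, x⟫ < s ∧ x ∉ A ∧ hyperplaneReflection u s x ∈ A} = 0) :
    ∃ c : E, ((fun x => (2 : ℝ) • c - x) ⁻¹' A : Set E) =ᵐ[volume] A := by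
  classical
  let b := stdOrthonormalBasis ℝ E
  have hb : ∀ i, ‖b i‖ = 1 := fun i => b.orthonormal.1 i
  choose s hs using fun i => exists_bisecting_hyperplane (hb i) hfin
  have hind : ∀ S : Finset (Fin (Module.finrank ℝ E)),
      ((fun x => x - ∑ i ∈ S, (2 * (⟪b i, x⟫ - s i)) • b i) ⁻¹' A : Set E) =ᵐ[volume] A := by
    intro S
    induction S using Finset.induction_on with
    | empty => simpa using ae_eq_refl A
    | insert j S hj ih =>
      have h1 := (measurePreserving_hyperplaneReflection (hb j) (s j)).quasiMeasurePreserving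
        |>.preimage_ae_eq ih
      have h2 := h1.trans
        (ae_eq_preimage_hyperplaneReflection (hb j) hA hfin (hpol _ _ (hb j)) (hs j))
      rw [← preimage_comp] at h2
      refine cast (congrArg (fun F : E → E => (F ⁻¹' A : Set E) =ᵐ[volume] A) ?_) h2
      ext x
      rw [Function.comp_apply, Finset.sum_insert hj, ← sub_sub]
      symm
      congr 1
      refine Finset.sum_congr rfl fun i hi => ?_
      have hij : i ≠ j := fun h => hj (h ▸ hi)
      rw [hyperplaneReflection, inner_sub_right, inner_smul_right, b.orthonormal.2 hij, mul_zero,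
        sub_zero]
  refine ⟨∑ i, s i • b i, ?_⟩
  have hx : ∀ x, ∑ i, ⟪b i, x⟫ • b i = x := b.sum_repr'
  have heq : (fun x => (2 : ℝ) • (∑ i, s i • b i) - x)
      = fun x => x - ∑ i, (2 * (⟪b i, x⟫ - s i)) • b i := by
    ext x
    simp_rw [mul_smul, ← Finset.smul_sum, sub_smul, Finset.sum_sub_distrib, hx, smul_sub, two_smul]
    abel
  rw [heq]
  exact hind Finset.univ

/-- A set that is symmetric about the origin and has only trivial polarizations is a ball: otherwise
some reflection moves a part of `A` outside the ball into the part of the ball outside `A`. Since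
the polarization is trivial, the side of the origin then has less of the volume of `A` than the other
side, which contradicts the symmetry. -/
theorem ae_eq_closedBall_of_symmetric [Nontrivial E] {A : Set E} (hA : MeasurableSet A) {r : ℝ}
    (hr : volume A = volume (closedBall (0 : E) r))
    (hsymm : (Neg.neg ⁻¹' A : Set E) =ᵐ[volume] A)
    (hpol : ∀ (u : E) (s : ℝ), ‖u‖ = 1 →
      volume {x | ⟪u, x⟫ < s ∧ x ∈ A ∧ hyperplaneReflection u s x ∉ A} = 0 ∨
      volume {x | ⟪u, x⟫ < s ∧ x ∉ A ∧ hyperplaneReflection u s x ∈ A} = 0) :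
    A =ᵐ[volume] closedBall (0 : E) r := by
  have hB : MeasurableSet (closedBall (0 : E) r) := measurableSet_closedBall
  have hBfin : volume (closedBall (0 : E) r) ≠ ∞ := measure_closedBall_lt_top.ne
  have hfin : volume A ≠ ∞ := hr ▸ hBfin
  have hdiff : volume (A \ closedBall (0 : E) r) = volume (closedBall (0 : E) r \ A) :=
    measure_sdiff_symm hA.nullMeasurableSet hB.nullMeasurableSet hr
      (measure_ne_top_of_subset inter_subset_left hfin)
  by_contra hne
  have hP0 : volume (A \ closedBall (0 : E) r) ≠ 0 := fun h =>
    hne (ae_eq_set.2 ⟨h, hdiff ▸ h⟩)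
  obtain ⟨N, hN⟩ : ∃ N : ℕ, volume ((A \ closedBall (0 : E) r) ∩ closedBall 0 N) ≠ 0 := by
    by_contra! h
    apply hP0
    rw [← inter_univ (A \ closedBall (0 : E) r), ← iUnion_closedBall_nat (0 : E), inter_iUnion]
    exact measure_iUnion_null h
  obtain ⟨C, -, hC⟩ := exists_reflection_lt_volume (E := E) (max r N)
  obtain ⟨u, s, hu, hs, hlt⟩ := hC A r _ hA ((hA.diff hB).inter measurableSet_closedBall)
    inter_subset_left
    (inter_subset_right.trans (closedBall_subset_closedBall (le_max_right _ _)))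
    (le_max_left _ _) 0 (by
      rw [mul_zero]; exact pos_iff_ne_zero.2 (mul_ne_zero hN (hdiff ▸ hP0)))
  have hS2 : volume {x | ⟪u, x⟫ < s ∧ x ∉ A ∧ hyperplaneReflection u s x ∈ A} ≠ 0 := by
    rw [← (measurePreserving_hyperplaneReflection hu s).measure_preimage
      ((((hA.diff hB).inter measurableSet_closedBall).inter
        (measurable_hyperplaneReflection u s (hB.diff hA))).nullMeasurableSet)] at hlt
    refine (hlt.trans_le (measure_mono ?_)).ne'
    rintro x ⟨⟨⟨hxA, hxB⟩, -⟩, hx⟩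
    rw [mem_preimage, hyperplaneReflection_involutive hu s x] at hx
    refine ⟨?_, hx.2, hxA⟩
    have hx1 := hx.1
    rw [mem_closedBall, dist_zero_right] at hxB hx1
    have h1 := norm_hyperplaneReflection_sq hu s x
    have h2 : ‖x‖ ^ 2 < ‖hyperplaneReflection u s x‖ ^ 2 :=
      pow_lt_pow_left₀ (hx1.trans_lt (not_le.1 hxB)) (norm_nonneg _) two_ne_zero
    have h3 : 0 < (4 * s) * (s - ⟪u, x⟫) := by linarith
    have := (mul_pos_iff_of_pos_left (by linarith)).1 h3
    linarith
  have hS1 := (hpol u s hu).resolve_right hS2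
  have h1 := volume_inter_halfSpace u s hA
  have h2 := volume_inter_halfSpace_compl hu s hA
  rw [hS1, add_zero] at h1
  have hle : volume (A ∩ {x | s < ⟪u, x⟫}) ≤ volume (A ∩ {x | ⟪u, x⟫ < s}) := by
    have hK : MeasurableSet {x : E | s < ⟪u, x⟫} := measurableSet_lt measurable_const (by fun_prop)
    rw [← (Measure.measurePreserving_neg (volume : Measure E)).measure_preimage
      (hA.inter hK).nullMeasurableSet, preimage_inter]
    refine (measure_congr (ae_eq_set_inter hsymm (ae_eq_refl _))).trans_le ?_
    refine measure_mono (inter_subset_inter_right _ fun x hx => ?_)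
    simp only [mem_preimage, mem_ofPred_eq, inner_neg_right] at hx ⊢
    linarith
  rw [h1, h2] at hle
  refine hS2 (le_zero_iff.1 ((ENNReal.add_le_add_iff_left
    (measure_ne_top_of_subset (fun x hx => hx.2.1) hfin)).1 (hle.trans_eq (add_zero _).symm)))

theorem rieszEnergy_preimage_add_right (β : ℝ) (A : Set E) (c : E) :
    rieszEnergy β ((· + c) ⁻¹' A) = rieszEnergy β A := by
  have hmp := measurePreserving_add_right (volume : Measure E) c
  have hemb := measurableEmbedding_addRight c
  have h : ∀ f : E → ℝ≥0∞, ∫⁻ x in (· + c) ⁻¹' A, f (x + c) = ∫⁻ x in A, f x := fun f =>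
    hmp.setLIntegral_comp_preimage_emb hemb f A
  rw [rieszEnergy, rieszEnergy, ← h]
  refine lintegral_congr fun x => ?_
  rw [← h]
  simp [rieszKernel]

/-- A set whose Riesz energy equals that of a ball of the same volume is a ball: no polarization can
increase its energy further, so that all its polarizations are trivial. -/
theorem exists_ae_eq_closedBall_of_rieszEnergy_eq [Nontrivial E] {β : ℝ} (hβ : 0 < β)
    (hβd : β < Module.finrank ℝ E) {A : Set E} (hA : MeasurableSet A) {r : ℝ}
    (hr : volume A = volume (closedBall (0 : E) r))
    (hE : rieszEnergy β A = rieszEnergy β (closedBall (0 : E) r)) :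
    ∃ c : E, A =ᵐ[volume] closedBall c r := by
  have hfin : volume A ≠ ∞ := hr ▸ measure_closedBall_lt_top.ne
  have hpol : ∀ B : Set E, MeasurableSet B → volume B = volume A →
      rieszEnergy β B = rieszEnergy β A → ∀ (u : E) (s : ℝ), ‖u‖ = 1 →
      volume {x | ⟪u, x⟫ < s ∧ x ∈ B ∧ hyperplaneReflection u s x ∉ B} = 0 ∨
      volume {x | ⟪u, x⟫ < s ∧ x ∉ B ∧ hyperplaneReflection u s x ∈ B} = 0 := by
    intro B hB hvB hEB u s hu
    by_contra! h
    refine (rieszEnergy_lt_polarization hβ hu s hB ?_ h.1 h.2).not_ge ?_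
    · exact rieszEnergy_lt_top hβ hβd (hvB ▸ hfin.lt_top)
    · rw [hEB, hE]
      exact rieszEnergy_le_closedBall hβ hβd (measurableSet_polarization u s hB)
        ((volume_polarization hu s hB).trans (hvB.trans hr))
  obtain ⟨c, hc⟩ := exists_ae_eq_preimage_pointReflection hA hfin (hpol A hA rfl rfl)
  have hmp := measurePreserving_add_right (volume : Measure E) c
  have hv : volume ((· + c) ⁻¹' A) = volume A := hmp.measure_preimage hA.nullMeasurableSet
  have hA' : MeasurableSet ((· + c) ⁻¹' A) := measurable_add_const c hA
  have h := ae_eq_closedBall_of_symmetric hA' (hv.trans hr) ?_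
    (hpol _ hA' hv (rieszEnergy_preimage_add_right β A c))
  · refine ⟨c, ?_⟩
    have h2 := (measurePreserving_add_right (volume : Measure E) (-c)).quasiMeasurePreserving
      |>.preimage_ae_eq h
    rw [← preimage_comp] at h2
    have h3 : (fun x : E => x + c) ∘ (fun x => x + -c) = id := by ext; simp
    have h4 : (fun x : E => x + -c) ⁻¹' closedBall 0 r = closedBall c r := by
      rw [preimage_add_right_closedBall]
      simp
    rwa [h3, preimage_id, h4] at h2
  · have h2 := hmp.quasiMeasurePreserving.preimage_ae_eq hc
    have h3 : Neg.neg ⁻¹' ((· + c) ⁻¹' A)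
        = (· + c) ⁻¹' ((fun x => (2 : ℝ) • c - x) ⁻¹' A) := by
      ext x
      simp only [mem_preimage, two_smul]
      rw [show c + c - (x + c) = -x + c by abel]
    rwa [h3]

/-! ### Integrals of powers of `1 - ‖x‖ ^ 2` over the unit ball -/

theorem lintegral_exp_neg_mul_rpow {b : ℝ} (hb : -1 < b) :
    ∫⁻ t in Ioi (0 : ℝ), ENNReal.ofReal (Real.exp (-t) * t ^ b) =
      ENNReal.ofReal (Real.Gamma (b + 1)) := by
  have h := Real.GammaIntegral_convergent (show 0 < b + 1 by linarith)
  rw [Real.Gamma_eq_integral (by linarith), ofReal_integral_eq_lintegral_ofReal h]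
  · simp
  · filter_upwards [ae_restrict_mem measurableSet_Ioi] with t ht
    have := mem_Ioi.1 ht
    positivity

theorem lintegral_comp_smul {g : E → ℝ≥0∞} (hg : Measurable g) {R : ℝ} (hR : 0 < R) :
    ENNReal.ofReal (R ^ Module.finrank ℝ E) * ∫⁻ x, g (R • x) = ∫⁻ x, g x := by
  have h1 : ∫⁻ x, g (R • x) = ∫⁻ x, g x ∂((volume : Measure E).map (R • ·)) := by
    rw [lintegral_map hg (by fun_prop)]
  rw [h1, Measure.map_addHaar_smul _ hR.ne', lintegral_smul_measure, smul_eq_mul, ← mul_assoc,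
    ← ENNReal.ofReal_mul (by positivity), abs_of_pos (by positivity),
    mul_inv_cancel₀ (by positivity), ENNReal.ofReal_one, one_mul]

theorem lintegral_rpow_sub_norm_sq {b s : ℝ} (hs : 0 < s) :
    ∫⁻ x : E, ENNReal.ofReal (max (s - ‖x‖ ^ 2) 0 ^ b) =
      ENNReal.ofReal (s ^ (b + Module.finrank ℝ E / 2)) *
        ∫⁻ x : E, ENNReal.ofReal (max (1 - ‖x‖ ^ 2) 0 ^ b) := by
  have hsq : 0 < √s := Real.sqrt_pos.2 hs
  rw [← lintegral_comp_smul (by fun_prop) hsq]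
  have h : ∀ x : E, ENNReal.ofReal (max (s - ‖√s • x‖ ^ 2) 0 ^ b)
      = ENNReal.ofReal (s ^ b) * ENNReal.ofReal (max (1 - ‖x‖ ^ 2) 0 ^ b) := by
    intro x
    rw [← ENNReal.ofReal_mul (by positivity), ← Real.mul_rpow hs.le (le_max_right _ _),
      mul_max_of_nonneg _ _ hs.le, norm_smul, mul_pow, Real.norm_eq_abs, sq_abs, Real.sq_sqrt hs.le]
    ring_nf
  simp only [h]
  rw [lintegral_const_mul' _ _ ENNReal.ofReal_ne_top, ← mul_assoc,
    ← ENNReal.ofReal_mul (by positivity), Real.rpow_add hs, mul_comm (s ^ b), Real.sqrt_eq_rpow,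
    ← Real.rpow_mul_natCast hs.le]
  ring_nf

/-- The Laplace transform in `s` of `s ↦ ∫ (s - ‖x‖²)₊ ^ b dx` is a Gaussian integral, while by
homogeneity it is `Γ(b + m / 2 + 1)` times the value at `s = 1`. This argument covers dimension
zero. -/
theorem lintegral_rpow_one_sub_norm_sq {b : ℝ} (hb : 0 < b) :
    ∫⁻ x : E, ENNReal.ofReal (max (1 - ‖x‖ ^ 2) 0 ^ b) =
      ENNReal.ofReal (Real.pi ^ (Module.finrank ℝ E / 2 : ℝ) * Real.Gamma (b + 1) /
        Real.Gamma (b + Module.finrank ℝ E / 2 + 1)) := by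
  set c := ∫⁻ x : E, ENNReal.ofReal (max (1 - ‖x‖ ^ 2) 0 ^ b)
  have hG : 0 < Real.Gamma (b + Module.finrank ℝ E / 2 + 1) := Real.Gamma_pos_of_pos (by positivity)
  have hzero : ∀ t : ℝ, t ∉ Ioi 0 → max t 0 ^ b = 0 := by
    intro t ht
    rw [max_eq_right (not_lt.1 ht), Real.zero_rpow hb.ne']
  have h1 : ∫⁻ s : ℝ, ∫⁻ x : E, ENNReal.ofReal (Real.exp (-s) * max (s - ‖x‖ ^ 2) 0 ^ b) =
      ENNReal.ofReal (Real.Gamma (b + Module.finrank ℝ E / 2 + 1)) * c := by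
    rw [← lintegral_exp_neg_mul_rpow (b := b + Module.finrank ℝ E / 2)
        (by linarith [show (0 : ℝ) ≤ Module.finrank ℝ E / 2 by positivity]),
      ← lintegral_mul_const _ (by fun_prop), ← lintegral_indicator measurableSet_Ioi]
    refine lintegral_congr fun s => ?_
    by_cases hs : s ∈ Ioi 0
    · rw [indicator_of_mem hs, ENNReal.ofReal_mul (by positivity), mul_assoc,
        ← lintegral_rpow_sub_norm_sq hs, ← lintegral_const_mul' _ _ ENNReal.ofReal_ne_top]
      refine lintegral_congr fun x => ENNReal.ofReal_mul (by positivity)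
    · rw [indicator_of_notMem hs]
      refine (lintegral_congr fun x => ?_).trans lintegral_zero
      rw [hzero _ (fun h => hs ((mem_Ioi.1 h).trans_le (by simp))), mul_zero, ENNReal.ofReal_zero]
  have h2 : ∫⁻ s : ℝ, ∫⁻ x : E, ENNReal.ofReal (Real.exp (-s) * max (s - ‖x‖ ^ 2) 0 ^ b) =
      ENNReal.ofReal (Real.Gamma (b + 1)) *
        ENNReal.ofReal (Real.pi ^ (Module.finrank ℝ E / 2 : ℝ)) := by
    rw [lintegral_lintegral_swap (by fun_prop)]
    have hx : ∀ x : E, ∫⁻ s : ℝ, ENNReal.ofReal (Real.exp (-s) * max (s - ‖x‖ ^ 2) 0 ^ b)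
        = ENNReal.ofReal (Real.Gamma (b + 1)) * ENNReal.ofReal (Real.exp (-1 * ‖x‖ ^ 2)) := by
      intro x
      rw [← lintegral_exp_neg_mul_rpow (by linarith), ← lintegral_mul_const _ (by fun_prop),
        ← lintegral_add_right_eq_self _ (‖x‖ ^ 2), ← lintegral_indicator measurableSet_Ioi]
      refine lintegral_congr fun t => ?_
      rw [add_sub_cancel_right]
      by_cases ht : t ∈ Ioi 0
      · rw [indicator_of_mem ht, ← ENNReal.ofReal_mul' (by positivity),
          max_eq_left (mem_Ioi.1 ht).le, neg_add, Real.exp_add]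
        ring_nf
      · rw [indicator_of_notMem ht, hzero _ ht, mul_zero, ENNReal.ofReal_zero]
    simp only [hx]
    rw [lintegral_const_mul' _ _ ENNReal.ofReal_ne_top]
    have hgauss := GaussianFourier.integral_rexp_neg_mul_sq_norm (V := E) one_pos
    rw [div_one] at hgauss
    rw [← hgauss, ofReal_integral_eq_lintegral_ofReal _ (.of_forall fun x => (Real.exp_pos _).le)]
    by_contra hint
    rw [integral_undef hint] at hgauss
    exact (by positivity : (0 : ℝ) < Real.pi ^ (Module.finrank ℝ E / 2 : ℝ)).ne hgauss
  rw [h1, mul_comm (ENNReal.ofReal (Real.Gamma (b + 1))), ← ENNReal.ofReal_mul (by positivity)]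
    at h2
  rw [ENNReal.ofReal_div_of_pos hG, ← h2, mul_comm, ENNReal.mul_div_cancel_right
    (by simpa using hG) ENNReal.ofReal_ne_top]

/-! ### Slicing along lines -/

theorem lintegral_eq_lintegral_orthogonal_lintegral {u : E} (hu : ‖u‖ = 1) {h : E → ℝ≥0∞}
    (hh : Measurable h) :
    ∫⁻ x, h x = ∫⁻ x : (ℝ ∙ u)ᗮ, ∫⁻ t : ℝ, h ((x : E) + t • u) := by
  have h1 : ∫⁻ x, h x = ∫⁻ p : (ℝ ∙ u) × (ℝ ∙ u)ᗮ, h ((p.1 : E) + p.2) := by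
    have e1 := ((ℝ ∙ u).orthogonalDecomposition.symm.measurePreserving).comp
      (WithLp.volume_preserving_toLp (ℝ ∙ u) (ℝ ∙ u)ᗮ)
    rw [← e1.lintegral_comp hh]
    refine lintegral_congr fun p => ?_
    congr 1
  have e2 := (LinearIsometryEquiv.toSpanUnitSingleton (𝕜 := ℝ) u hu).measurePreserving
  rw [h1, Measure.volume_eq_prod, lintegral_prod_symm _ (by fun_prop)]
  refine lintegral_congr fun x => ?_
  rw [← e2.lintegral_comp (by fun_prop)]
  refine lintegral_congr fun t => ?_
  rw [LinearIsometryEquiv.toSpanUnitSingleton_apply, add_comm]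

/-- The Riesz energy of an interval, with each pair of points counted once. -/
theorem lintegral_Icc_rpow_energy {α : ℝ} (hα : 0 < α) {a b : ℝ} (hab : a ≤ b) :
    ∫⁻ s in Icc a b, ∫⁻ τ in Ioi (0 : ℝ),
      ENNReal.ofReal (τ ^ (α - 1)) * (Icc a b).indicator 1 (s + τ) =
      ENNReal.ofReal ((b - a) ^ (α + 1) / (α * (α + 1))) := by
  have hinner : ∀ s ∈ Icc a b, ∫⁻ τ in Ioi (0 : ℝ),
      ENNReal.ofReal (τ ^ (α - 1)) * (Icc a b).indicator 1 (s + τ) =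
      ENNReal.ofReal ((b - s) ^ α / α) := by
    intro s hs
    have h0 : 0 ≤ b - s := sub_nonneg.2 hs.2
    have hint : IntervalIntegrable (fun τ : ℝ => τ ^ (α - 1)) volume 0 (b - s) :=
      intervalIntegral.intervalIntegrable_rpow' (by linarith)
    have hval : ∫ τ in Ioc 0 (b - s), τ ^ (α - 1) = (b - s) ^ α / α := by
      rw [← intervalIntegral.integral_of_le h0, integral_rpow (.inl (by linarith)),
        sub_add_cancel, Real.zero_rpow hα.ne', sub_zero]
    rw [← hval, ofReal_integral_eq_lintegral_ofReal hint.1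
      ((ae_restrict_iff' measurableSet_Ioc).2 (.of_forall fun τ hτ => Real.rpow_nonneg hτ.1.le _)),
      ← lintegral_indicator measurableSet_Ioi, ← lintegral_indicator measurableSet_Ioc]
    refine lintegral_congr fun τ => ?_
    by_cases hτ : 0 < τ
    · by_cases hτb : τ ≤ b - s
      · rw [indicator_of_mem (mem_Ioi.2 hτ), indicator_of_mem (mem_Ioc.2 ⟨hτ, hτb⟩),
          indicator_of_mem (by constructor <;> linarith [hs.1])]
        simp
      · rw [indicator_of_mem (mem_Ioi.2 hτ), indicator_of_notMem (fun h => hτb (by linarith [h.2])),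
          indicator_of_notMem (fun h => hτb h.2), mul_zero]
    · rw [indicator_of_notMem (by simpa using hτ), indicator_of_notMem (fun h => hτ h.1)]
  rw [setLIntegral_congr_fun measurableSet_Icc hinner]
  have hint : IntervalIntegrable (fun s : ℝ => (b - s) ^ α / α) volume a b :=
    (Continuous.intervalIntegrable (by fun_prop (disch := exact hα.le)) a b)
  have hval : ∫ s in Ioc a b, (b - s) ^ α / α = (b - a) ^ (α + 1) / (α * (α + 1)) := by
    rw [← intervalIntegral.integral_of_le hab, intervalIntegral.integral_div,
      intervalIntegral.integral_comp_sub_left (fun x => x ^ α), sub_self,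
      integral_rpow (.inl (by linarith)), Real.zero_rpow (by linarith)]
    field_simp
    ring
  rw [← hval, ofReal_integral_eq_lintegral_ofReal hint.1
    ((ae_restrict_iff' measurableSet_Ioc).2 (.of_forall fun s hs =>
      div_nonneg (Real.rpow_nonneg (by linarith [hs.2]) _) hα.le)),
    setLIntegral_congr Ioc_ae_eq_Icc]

/-! ### The Riesz energy and the chord power integral of a ball -/

omit [MeasurableSpace E] [BorelSpace E] [FiniteDimensional ℝ E] in
/-- The condition for a point of the line `x + ℝ u` to lie in the unit ball. -/
theorem add_smul_mem_closedBall_iff {u : E} (hu : ‖u‖ = 1) (x : (ℝ ∙ u)ᗮ) (t : ℝ) :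
    (x : E) + t • u ∈ closedBall (0 : E) 1 ↔ t ^ 2 ≤ 1 - ‖x‖ ^ 2 := by
  have h : ⟪(x : E), t • u⟫ = 0 := by
    rw [inner_smul_right, Submodule.mem_orthogonal_singleton_iff_inner_left.1 x.2, mul_zero]
  rw [mem_closedBall, dist_zero_right, ← sq_le_one_iff₀ (norm_nonneg _), norm_add_sq_real, h,
    norm_smul, hu, mul_one, Real.norm_eq_abs, sq_abs, Submodule.coe_norm]
  constructor <;> intro h <;> linarith

omit [MeasurableSpace E] [BorelSpace E] [FiniteDimensional ℝ E] in
theorem setOf_add_smul_mem_closedBall {u : E} (hu : ‖u‖ = 1) {x : (ℝ ∙ u)ᗮ} (hx : ‖x‖ ≤ 1) :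
    {t : ℝ | (x : E) + t • u ∈ closedBall (0 : E) 1} =
      Icc (-√(1 - ‖x‖ ^ 2)) (√(1 - ‖x‖ ^ 2)) := by
  ext t
  rw [mem_ofPred_eq, add_smul_mem_closedBall_iff hu, mem_Icc, ← abs_le]
  refine ⟨Real.abs_le_sqrt, fun h => ?_⟩
  rw [← sq_abs, ← Real.sq_sqrt (show 0 ≤ 1 - ‖x‖ ^ 2 by nlinarith [norm_nonneg x])]
  gcongr

omit [MeasurableSpace E] [BorelSpace E] [FiniteDimensional ℝ E] in
theorem setOf_add_smul_mem_closedBall_eq_empty {u : E} (hu : ‖u‖ = 1) {x : (ℝ ∙ u)ᗮ}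
    (hx : ¬ ‖x‖ ≤ 1) : {t : ℝ | (x : E) + t • u ∈ closedBall (0 : E) 1} = ∅ := by
  rw [eq_empty_iff_forall_notMem]
  intro t ht
  rw [mem_ofPred_eq, add_smul_mem_closedBall_iff hu] at ht
  nlinarith [sq_nonneg t]

omit [FiniteDimensional ℝ E] [MeasurableSpace E] [BorelSpace E] in
theorem volume_setOf_add_smul_mem_closedBall {u : E} (hu : ‖u‖ = 1) (x : (ℝ ∙ u)ᗮ) :
    volume {t : ℝ | (x : E) + t • u ∈ closedBall (0 : E) 1} =
      ENNReal.ofReal (2 * √(1 - ‖x‖ ^ 2)) := by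
  by_cases hx : ‖x‖ ≤ 1
  · rw [setOf_add_smul_mem_closedBall hu hx, Real.volume_Icc]
    ring_nf
  · rw [setOf_add_smul_mem_closedBall_eq_empty hu hx, measure_empty,
      Real.sqrt_eq_zero_of_nonpos (by nlinarith), mul_zero, ENNReal.ofReal_zero]

/-- The integral of the power `α + 1` of the lengths of the chords of the unit ball in a fixed
direction, in dimension `d`. -/
def ballChordConst (d : ℕ) (α : ℝ) : ℝ :=
  2 ^ (α + 1) * (Real.pi ^ (((d : ℝ) - 1) / 2) * Real.Gamma ((α + 1) / 2 + 1) /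
    Real.Gamma ((α + 1) / 2 + ((d : ℝ) - 1) / 2 + 1))

omit [MeasurableSpace E] [BorelSpace E] in
theorem finrank_orthogonal_singleton {u : E} (hu : ‖u‖ = 1) :
    (Module.finrank ℝ (ℝ ∙ u)ᗮ : ℝ) = Module.finrank ℝ E - 1 := by
  have h := (ℝ ∙ u).finrank_add_finrank_orthogonal
  rw [finrank_span_singleton (by rintro rfl; simp at hu)] at h
  rw [← h]
  push_cast
  ring

theorem lintegral_chord_rpow {α : ℝ} (hα : 0 < α) {u : E} (hu : ‖u‖ = 1) :
    ∫⁻ x : (ℝ ∙ u)ᗮ, ENNReal.ofReal ((2 * √(1 - ‖x‖ ^ 2)) ^ (α + 1)) =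
      ENNReal.ofReal (ballChordConst (Module.finrank ℝ E) α) := by
  have h : ∀ x : (ℝ ∙ u)ᗮ, ENNReal.ofReal ((2 * √(1 - ‖x‖ ^ 2)) ^ (α + 1)) =
      ENNReal.ofReal (2 ^ (α + 1)) *
        ENNReal.ofReal (max (1 - ‖x‖ ^ 2) 0 ^ ((α + 1) / 2)) := by
    intro x
    rw [← ENNReal.ofReal_mul (by positivity), Real.mul_rpow two_pos.le (Real.sqrt_nonneg _)]
    congr 2
    have hmax : √(1 - ‖x‖ ^ 2) = √(max (1 - ‖x‖ ^ 2) 0) := by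
      rcases le_total (1 - ‖x‖ ^ 2) 0 with h | h
      · rw [max_eq_right h, Real.sqrt_eq_zero_of_nonpos h, Real.sqrt_zero]
      · rw [max_eq_left h]
    rw [hmax, Real.sqrt_eq_rpow, ← Real.rpow_mul (le_max_right _ _)]
    ring_nf
  simp only [h]
  rw [lintegral_const_mul' _ _ ENNReal.ofReal_ne_top, lintegral_rpow_one_sub_norm_sq (by linarith),
    ← ENNReal.ofReal_mul (by positivity), finrank_orthogonal_singleton hu, ballChordConst]

theorem lintegral_rieszKernel_eq_polar [Nontrivial E] (β : ℝ) {A : Set E} (hA : MeasurableSet A)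
    (x : E) :
    ∫⁻ y in A, rieszKernel β x y = ∫⁻ u : sphere (0 : E) 1, (∫⁻ τ in Ioi (0 : ℝ),
      ENNReal.ofReal (τ ^ ((Module.finrank ℝ E : ℝ) - β - 1)) *
        A.indicator 1 (x + τ • (u : E))) ∂(volume : Measure E).toSphere := by
  have h1 : Measurable (A.indicator (1 : E → ℝ≥0∞)) := measurable_one.indicator hA
  have hd : 0 < Module.finrank ℝ E := Module.finrank_pos
  have h2 : ∫⁻ y in A, rieszKernel β x y = ∫⁻ z, A.indicator 1 (x + z) * (‖z‖ₑ ^ β)⁻¹ := by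
    rw [← lintegral_indicator hA, ← lintegral_add_left_eq_self _ x]
    refine lintegral_congr fun z => ?_
    by_cases hz : x + z ∈ A
    · simp [hz, rieszKernel]
    · simp [hz]
  rw [h2, lintegral_eq_lintegral_sphere_Ioi (by fun_prop)]
  refine lintegral_congr fun u => setLIntegral_congr_fun measurableSet_Ioi fun τ hτ => ?_
  have hτ : 0 < τ := hτ
  have hn : ‖τ • (u : E)‖ = τ := by simp [norm_smul, abs_of_pos hτ]
  rw [← ofReal_norm, hn, ENNReal.ofReal_rpow_of_pos hτ, ← ENNReal.ofReal_inv_of_pos (by positivity),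
    mul_left_comm, ← ENNReal.ofReal_mul (by positivity), mul_comm, ← Real.rpow_neg hτ.le,
    ← Real.rpow_natCast, ← Real.rpow_add hτ, Nat.cast_pred hd]
  ring_nf

/-- Pairs of points of the unit ball are parametrized by the line joining them and their positions
on this line, which turns the Riesz energy into an integral of powers of chord lengths. -/
theorem rieszEnergy_unitBall [Nontrivial E] {α : ℝ} (hα : 0 < α) :
    rieszEnergy ((Module.finrank ℝ E : ℝ) - α) (closedBall (0 : E) 1) =
      ENNReal.ofReal (ballChordConst (Module.finrank ℝ E) α / (α * (α + 1))) *
        (volume : Measure E).toSphere univ := by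
  have hB : MeasurableSet (closedBall (0 : E) 1) := measurableSet_closedBall
  have h1 : Measurable ((closedBall (0 : E) 1).indicator (1 : E → ℝ≥0∞)) :=
    measurable_one.indicator hB
  rw [rieszEnergy]
  simp only [lintegral_rieszKernel_eq_polar _ hB]
  have h2 : Measurable fun p : (E × sphere (0 : E) 1) × ℝ =>
      ENNReal.ofReal (p.2 ^ ((Module.finrank ℝ E : ℝ) - (Module.finrank ℝ E - α) - 1)) *
        (closedBall (0 : E) 1).indicator (1 : E → ℝ≥0∞) (p.1.1 + p.2 • (p.1.2 : E)) := by
    fun_prop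
  rw [lintegral_lintegral_swap h2.lintegral_prod_right'.aemeasurable, ← lintegral_const]
  refine lintegral_congr fun u => ?_
  have hu : ‖(u : E)‖ = 1 := norm_eq_of_mem_sphere u
  have h3 : Measurable fun x : E => ∫⁻ τ in Ioi (0 : ℝ),
      ENNReal.ofReal (τ ^ ((Module.finrank ℝ E : ℝ) - (Module.finrank ℝ E - α) - 1)) *
        (closedBall (0 : E) 1).indicator (1 : E → ℝ≥0∞) (x + τ • (u : E)) :=
    (h2.comp (f := fun p : E × ℝ => ((p.1, u), p.2)) (by fun_prop)).lintegral_prod_right'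
  rw [← lintegral_indicator hB,
    lintegral_eq_lintegral_orthogonal_lintegral hu (h3.indicator hB)]
  have hc : ENNReal.ofReal (ballChordConst (Module.finrank ℝ E) α / (α * (α + 1))) =
      (∫⁻ x : (ℝ ∙ (u : E))ᗮ, ENNReal.ofReal ((2 * √(1 - ‖x‖ ^ 2)) ^ (α + 1))) *
        ENNReal.ofReal (1 / (α * (α + 1))) := by
    rw [lintegral_chord_rpow hα hu, ← ENNReal.ofReal_mul' (by positivity), mul_one_div]
  rw [hc, ← lintegral_mul_const' _ _ ENNReal.ofReal_ne_top]
  refine lintegral_congr fun x => ?_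
  rw [← ENNReal.ofReal_mul' (by positivity), mul_one_div]
  by_cases hx : ‖x‖ ≤ 1
  · have hρ := Real.sqrt_nonneg (1 - ‖x‖ ^ 2)
    have hmem : ∀ t : ℝ, (x : E) + t • (u : E) ∈ closedBall (0 : E) 1 ↔
        t ∈ Icc (-√(1 - ‖x‖ ^ 2)) (√(1 - ‖x‖ ^ 2)) := fun t => by
      rw [← setOf_add_smul_mem_closedBall hu hx, mem_ofPred_eq]
    have hE := lintegral_Icc_rpow_energy hα (neg_le_self hρ)
    rw [sub_neg_eq_add, ← two_mul] at hE
    rw [← hE, ← lintegral_indicator measurableSet_Icc]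
    refine lintegral_congr fun s => ?_
    classical
    simp only [indicator_apply, hmem, add_assoc, ← add_smul, sub_sub_cancel, Pi.one_apply]
  · have hmem : ∀ t : ℝ, (x : E) + t • (u : E) ∉ closedBall (0 : E) 1 := fun t => by
      have := setOf_add_smul_mem_closedBall_eq_empty hu hx
      exact fun h => (this ▸ (show t ∈ {t : ℝ | (x : E) + t • (u : E) ∈ closedBall (0 : E) 1}
        from h) : t ∈ (∅ : Set ℝ))
    simp only [indicator_of_notMem (hmem _)]
    rw [Real.sqrt_eq_zero_of_nonpos (by nlinarith), mul_zero, Real.zero_rpow (by linarith),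
      zero_div, ENNReal.ofReal_zero, lintegral_zero]

theorem chordPowerIntegral_unitBall {n : ℕ} (hn : n ≠ 0) {α : ℝ} (hα : 0 < α) :
    chordPowerIntegral n (α + 1) (closedBall 0 1) = ENNReal.ofReal (ballChordConst n α) := by
  have : Nontrivial (EuclideanSpace ℝ (Fin n)) :=
    Module.nontrivial_of_finrank_pos (R := ℝ) (by simpa using Nat.pos_of_ne_zero hn)
  have h : ∀ u : sphere (0 : EuclideanSpace ℝ (Fin n)) 1,
      ∫⁻ x : (Submodule.span ℝ {(u : EuclideanSpace ℝ (Fin n))})ᗮ,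
        (volume {t : ℝ | (x : EuclideanSpace ℝ (Fin n)) + t • (u : EuclideanSpace ℝ (Fin n)) ∈
          closedBall (0 : EuclideanSpace ℝ (Fin n)) 1}) ^ (α + 1)
      ∂(stdOrthonormalBasis ℝ
          (Submodule.span ℝ {(u : EuclideanSpace ℝ (Fin n))})ᗮ).toBasis.addHaar
      = ENNReal.ofReal (ballChordConst n α) := by
    intro u
    have hu : ‖(u : EuclideanSpace ℝ (Fin n))‖ = 1 := norm_eq_of_mem_sphere u
    rw [OrthonormalBasis.addHaar_eq_volume]
    have := lintegral_chord_rpow hα hu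
    rw [finrank_euclideanSpace_fin] at this
    rw [← this]
    refine lintegral_congr fun x => ?_
    rw [volume_setOf_add_smul_mem_closedBall hu, ENNReal.ofReal_rpow_of_nonneg (by positivity)
      (by linarith)]
  rw [chordPowerIntegral]
  simp only [h]
  rw [lintegral_const, ENNReal.mul_div_cancel_right]
  · rw [Ne, Measure.measure_univ_eq_zero]
    exact Measure.toSphere_ne_zero _
  · exact measure_ne_top _ _

/-! ### The sharp constant -/

theorem ballChordConst_pos {d : ℕ} {α : ℝ} (hd : 1 ≤ d) (hα : 0 < α) : 0 < ballChordConst d α := by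
  have hd' : (1 : ℝ) ≤ d := by exact_mod_cast hd
  have h1 := Real.Gamma_pos_of_pos (show 0 < (α + 1) / 2 + 1 by linarith)
  have h2 := Real.Gamma_pos_of_pos (show 0 < (α + 1) / 2 + ((d : ℝ) - 1) / 2 + 1 by linarith)
  unfold ballChordConst
  positivity

theorem chordSobolevConst_eq {n : ℕ} (hn : n ≠ 0) {α : ℝ} (hα : 0 < α) :
    chordSobolevConst n α = n * ballChordConst n α / (|α| * (α + 1) *
      (volume (closedBall (0 : EuclideanSpace ℝ (Fin n)) 1)).toReal ^ (α / n)) := by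
  have : Nonempty (Fin n) := ⟨⟨0, Nat.pos_of_ne_zero hn⟩⟩
  have hn' : (0 : ℝ) < n := by exact_mod_cast Nat.pos_of_ne_zero hn
  have hG := Real.Gamma_pos_of_pos (show 0 < (n : ℝ) / 2 + 1 by positivity)
  have hG2 := Real.Gamma_pos_of_pos (show 0 < ((n : ℝ) + α) / 2 + 1 by positivity)
  have hω : (volume (closedBall (0 : EuclideanSpace ℝ (Fin n)) 1)).toReal =
      Real.pi ^ ((n : ℝ) / 2) / Real.Gamma ((n : ℝ) / 2 + 1) := by
    rw [EuclideanSpace.volume_closedBall, Fintype.card_fin, ENNReal.ofReal_one, one_pow, one_mul,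
      ENNReal.toReal_ofReal (by positivity), Real.sqrt_eq_rpow, ← Real.rpow_mul_natCast
      Real.pi_pos.le]
    ring_nf
  rw [hω, Real.div_rpow (by positivity) hG.le, ← Real.rpow_mul Real.pi_pos.le, chordSobolevConst,
    ballChordConst, Real.Gamma_add_one (by positivity : (α + 1) / 2 ≠ 0),
    show (α + 1) / 2 + ((n : ℝ) - 1) / 2 + 1 = (n + α) / 2 + 1 by ring,
    show (n : ℝ) / 2 * (α / n) = α / 2 by field_simp,
    show ((n : ℝ) - α - 1) / 2 = (n - 1) / 2 - α / 2 by ring, Real.rpow_sub Real.pi_pos,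
    Real.rpow_add two_pos, Real.rpow_one]
  have h3 : 0 < Real.Gamma ((n : ℝ) / 2 + 1) ^ (α / n) := by positivity
  field_simp

theorem chordSobolevConst_pos {n : ℕ} (hn : n ≠ 0) {α : ℝ} (hα : 0 < α) :
    0 < chordSobolevConst n α := by
  have hn' : (0 : ℝ) < n := by exact_mod_cast Nat.pos_of_ne_zero hn
  have h1 := ballChordConst_pos (Nat.one_le_iff_ne_zero.2 hn) hα
  have h2 : 0 < (volume (closedBall (0 : EuclideanSpace ℝ (Fin n)) 1)).toReal :=
    ENNReal.toReal_pos (measure_closedBall_pos _ _ one_pos).ne' measure_closedBall_lt_top.ne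
  rw [chordSobolevConst_eq hn hα]
  positivity

theorem rieszEnergy_closedBall_eq_mul (β : ℝ) (c : E) {r : ℝ} (hr : 0 < r) :
    rieszEnergy β (closedBall c r) = ENNReal.ofReal (r ^ (2 * (Module.finrank ℝ E : ℝ) - β)) *
      rieszEnergy β (closedBall (0 : E) 1) := by
  classical
  have htrans : closedBall c r = (· + -c) ⁻¹' closedBall 0 r := by
    rw [preimage_add_right_closedBall]; simp
  have hB : MeasurableSet (closedBall (0 : E) r) := measurableSet_closedBall
  have h1 : Measurable ((closedBall (0 : E) r).indicator (1 : E → ℝ≥0∞)) :=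
    measurable_one.indicator hB
  have hind : ∀ x : E, (closedBall (0 : E) r).indicator (1 : E → ℝ≥0∞) (r • x) =
      (closedBall (0 : E) 1).indicator 1 x := by
    intro x
    have : r • x ∈ closedBall (0 : E) r ↔ x ∈ closedBall (0 : E) 1 := by
      rw [mem_closedBall, mem_closedBall, dist_zero_right, dist_zero_right, norm_smul,
        Real.norm_eq_abs, abs_of_pos hr, mul_le_iff_le_one_right hr]
    simp only [indicator_apply, this, Pi.one_apply]
  have hk : ∀ x y : E, rieszKernel β (r • x) (r • y) =
      ENNReal.ofReal (r ^ (-β)) * rieszKernel β x y := by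
    intro x y
    rw [rieszKernel, rieszKernel, ← smul_sub, enorm_smul, Real.enorm_eq_ofReal hr.le,
      ENNReal.mul_rpow_of_ne_top ENNReal.ofReal_ne_top enorm_ne_top, ENNReal.ofReal_rpow_of_pos hr,
      ENNReal.mul_inv (.inl (by simpa using Real.rpow_pos_of_pos hr _))
        (.inl ENNReal.ofReal_ne_top), ← ENNReal.ofReal_inv_of_pos (by positivity),
      ← Real.rpow_neg hr.le]
  have h2 : Measurable fun p : E × E => (closedBall (0 : E) r).indicator (1 : E → ℝ≥0∞) p.1 *
      ((closedBall (0 : E) r).indicator 1 p.2 * rieszKernel β p.1 p.2) := by fun_prop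
  rw [htrans, rieszEnergy_preimage_add_right, rieszEnergy_eq_lintegral_indicator _ hB,
    rieszEnergy_eq_lintegral_indicator _ measurableSet_closedBall,
    ← lintegral_comp_smul h2.lintegral_prod_right' hr]
  have hc : ENNReal.ofReal (r ^ (2 * (Module.finrank ℝ E : ℝ) - β)) =
      ENNReal.ofReal (r ^ Module.finrank ℝ E) * (ENNReal.ofReal (r ^ Module.finrank ℝ E) *
        ENNReal.ofReal (r ^ (-β))) := by
    rw [← ENNReal.ofReal_mul (by positivity), ← ENNReal.ofReal_mul (by positivity),
      ← Real.rpow_natCast, ← Real.rpow_add hr, ← Real.rpow_add hr]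
    ring_nf
  rw [hc, mul_assoc, ← lintegral_const_mul' (ENNReal.ofReal (r ^ Module.finrank ℝ E) *
    ENNReal.ofReal (r ^ (-β))) _ (by finiteness)]
  congr 1
  refine lintegral_congr fun x => ?_
  have h3 : Measurable fun y : E => (closedBall (0 : E) r).indicator (1 : E → ℝ≥0∞) (r • x) *
      ((closedBall (0 : E) r).indicator 1 y * rieszKernel β (r • x) y) := by fun_prop
  rw [← lintegral_comp_smul h3 hr, mul_assoc,
    ← lintegral_const_mul' (ENNReal.ofReal (r ^ (-β))) _ (by finiteness)]
  congr 1
  refine lintegral_congr fun y => ?_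
  rw [hind, hind, hk]
  ring

/-- The Riesz energy of a ball in terms of its volume. -/
theorem rieszEnergy_closedBall {n : ℕ} (hn : n ≠ 0) {α : ℝ} (hα : 0 < α)
    (c : EuclideanSpace ℝ (Fin n)) {r : ℝ} (hr : 0 ≤ r) :
    rieszEnergy ((n : ℝ) - α) (closedBall c r) =
      ENNReal.ofReal (chordSobolevConst n α) * volume (closedBall c r) ^ (((n : ℝ) + α) / n) := by
  have hn' : (0 : ℝ) < n := by exact_mod_cast Nat.pos_of_ne_zero hn
  have : Nontrivial (EuclideanSpace ℝ (Fin n)) :=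
    Module.nontrivial_of_finrank_pos (R := ℝ) (by simpa using Nat.pos_of_ne_zero hn)
  have hd : Module.finrank ℝ (EuclideanSpace ℝ (Fin n)) = n := finrank_euclideanSpace_fin
  rcases hr.eq_or_lt with rfl | hr
  · have h0 : volume (closedBall c (0 : ℝ)) = 0 := by simp
    rw [h0, ENNReal.zero_rpow_of_pos (by positivity), mul_zero, rieszEnergy,
      Measure.restrict_eq_zero.2 h0, lintegral_zero_measure]
  set ω := (volume (closedBall (0 : EuclideanSpace ℝ (Fin n)) 1)).toReal with hω
  have hω0 : 0 < ω :=
    ENNReal.toReal_pos (measure_closedBall_pos _ _ one_pos).ne' measure_closedBall_lt_top.ne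
  have hωv : volume (closedBall (0 : EuclideanSpace ℝ (Fin n)) 1) = ENNReal.ofReal ω :=
    (ENNReal.ofReal_toReal measure_closedBall_lt_top.ne).symm
  have hW := ballChordConst_pos (Nat.one_le_iff_ne_zero.2 hn) hα
  have hE := rieszEnergy_unitBall (E := EuclideanSpace ℝ (Fin n)) hα
  rw [Measure.toSphere_apply_univ, ← Measure.addHaar_closedBall_eq_addHaar_ball, hd, hωv] at hE
  have hv := Measure.addHaar_closedBall_mul volume c hr.le zero_le_one
  rw [mul_one, hd, hωv] at hv
  rw [rieszEnergy_closedBall_eq_mul _ _ hr, hd, hE, hv, chordSobolevConst_eq hn hα, abs_of_pos hα,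
    ← hω, ← ENNReal.ofReal_natCast, ← ENNReal.ofReal_mul (by positivity),
    ← ENNReal.ofReal_mul (by positivity), ← ENNReal.ofReal_mul (by positivity),
    ← ENNReal.ofReal_mul (by positivity), ENNReal.ofReal_rpow_of_pos (by positivity),
    ← ENNReal.ofReal_mul (by positivity)]
  congr 1
  have h1 : (r ^ n * ω) ^ (((n : ℝ) + α) / n) = r ^ ((n : ℝ) + α) * (ω * ω ^ (α / n)) := by
    rw [Real.mul_rpow (by positivity) hω0.le, ← Real.rpow_natCast, ← Real.rpow_mul hr.le,
      mul_div_cancel₀ _ hn'.ne', add_div, div_self hn'.ne', Real.rpow_add hω0, Real.rpow_one]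
  have h2 : 0 < ω ^ (α / n) := by positivity
  rw [h1, show 2 * (n : ℝ) - (n - α) = n + α by ring]
  field_simp

/-! ### The distribution function -/

section DistributionFunction

variable {Ω : Type*} [MeasurableSpace Ω] {μ : Measure Ω} {g : Ω → ℝ}

theorem antitone_measure_setOf_lt (μ : Measure Ω) (g : Ω → ℝ) :
    Antitone fun t : ℝ => μ {x | t < g x} :=
  fun _ _ hst => measure_mono fun _ hx => lt_of_le_of_lt hst hx

theorem measurable_measure_setOf_lt (μ : Measure Ω) (g : Ω → ℝ) :
    Measurable fun t : ℝ => μ {x | t < g x} := (antitone_measure_setOf_lt μ g).measurable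

theorem measurable_indicator_setOf_lt (hg : Measurable g) :
    Measurable fun p : ℝ × Ω => {x | p.1 < g x}.indicator (1 : Ω → ℝ≥0∞) p.2 := by
  have h : MeasurableSet {p : ℝ × Ω | p.1 < g p.2} :=
    measurableSet_lt measurable_fst (hg.comp measurable_snd)
  exact measurable_one.indicator h

/-- Integrating a function of the level against the distribution function. -/
theorem lintegral_distribution_mul [SFinite μ] (hg : Measurable g) {w : ℝ → ℝ≥0∞}
    (hw : Measurable w) :
    ∫⁻ t in Ioi 0, μ {x | t < g x} * w t = ∫⁻ x, ∫⁻ t in Ioo 0 (g x), w t ∂volume ∂μ := by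
  have h1 := measurable_indicator_setOf_lt hg
  have h2 : ∀ t : ℝ, μ {x | t < g x} * w t =
      ∫⁻ x, {x | t < g x}.indicator (1 : Ω → ℝ≥0∞) x * w t ∂μ := by
    intro t
    have h3 : MeasurableSet {x | t < g x} := measurableSet_lt measurable_const hg
    rw [lintegral_mul_const _ (measurable_one.indicator h3), lintegral_indicator_one h3]
  simp only [h2]
  rw [lintegral_lintegral_swap (h1.mul (hw.comp measurable_fst)).aemeasurable]
  refine lintegral_congr fun x => ?_
  rw [← lintegral_indicator measurableSet_Ioi, ← lintegral_indicator measurableSet_Ioo]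
  refine lintegral_congr fun t => ?_
  classical
  simp only [indicator_apply, mem_Ioi, mem_Ioo, mem_ofPred_eq, Pi.one_apply, ite_mul, one_mul,
    zero_mul, ← ite_and]

variable {q : ℝ}

theorem lintegral_distribution_rpow [SFinite μ] (hg : Measurable g) (hq : 1 < q) :
    ∫⁻ t in Ioi 0, μ {x | t < g x} ^ q =
      ∫⁻ x, ∫⁻ t in Ioo 0 (g x), μ {y | t < g y} ^ (q - 1) ∂volume ∂μ := by
  rw [← lintegral_distribution_mul hg ((measurable_measure_setOf_lt μ g).pow_const _)]
  refine lintegral_congr fun t => ?_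
  nth_rw 2 [← ENNReal.rpow_one (μ {x | t < g x})]
  rw [← ENNReal.rpow_add_of_nonneg _ _ zero_le_one (by linarith)]
  ring_nf

/-- Hölder's inequality on `(0, T)`. -/
theorem setLIntegral_distribution_rpow_le (μ : Measure Ω) (g : Ω → ℝ) (hq : 1 < q) (T : ℝ) :
    ∫⁻ t in Ioo 0 T, μ {y | t < g y} ^ (q - 1) ≤
      ENNReal.ofReal T ^ (1 / q) * (∫⁻ t in Ioo 0 T, μ {y | t < g y} ^ q) ^ (1 - 1 / q) := by
  have hconj := Real.HolderConjugate.conjExponent hq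
  have hm := measurable_measure_setOf_lt μ g
  have h := ENNReal.lintegral_mul_le_Lp_mul_Lq (volume.restrict (Ioo 0 T)) hconj
    (f := fun _ => 1) (g := fun t => μ {y | t < g y} ^ (q - 1)) aemeasurable_const
    (hm.pow_const _).aemeasurable
  have he : (q - 1) * q.conjExponent = q := by
    rw [Real.conjExponent]; field_simp [show q - 1 ≠ 0 by linarith]
  simp only [Pi.mul_apply, one_mul, ENNReal.one_rpow, ← ENNReal.rpow_mul, he, lintegral_one,
    Measure.restrict_apply_univ, Real.volume_Ioo, sub_zero] at h
  refine h.trans_eq ?_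
  congr 2
  rw [Real.conjExponent]
  field_simp

/-- Chebyshev's inequality bounds the integral up to a non-sharp constant. -/
theorem lintegral_distribution_rpow_lt_top [SFinite μ] (hg : Measurable g) (hq : 1 < q)
    (hM : ∫⁻ x, ENNReal.ofReal (g x) ^ (1 / q) ∂μ ≠ ∞) :
    ∫⁻ t in Ioi 0, μ {x | t < g x} ^ q < ∞ := by
  set M := ∫⁻ x, ENNReal.ofReal (g x) ^ (1 / q) ∂μ
  have hq0 : 0 < q := by linarith
  have hcheb : ∀ t : ℝ, 0 < t → μ {x | t < g x} ^ (q - 1) ≤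
      M ^ (q - 1) * ENNReal.ofReal (t ^ (-(q - 1) / q)) := by
    intro t ht
    have h1 : ENNReal.ofReal t ^ (1 / q) * μ {x | t < g x} ≤ M := by
      refine le_trans (mul_le_mul' le_rfl (measure_mono fun x hx => ?_))
        (mul_meas_ge_le_lintegral (hg.ennreal_ofReal.pow_const (1 / q))
          (ENNReal.ofReal t ^ (1 / q)))
      exact ENNReal.rpow_le_rpow (ENNReal.ofReal_le_ofReal (le_of_lt hx)) (by positivity)
    rw [ENNReal.ofReal_rpow_of_pos ht] at h1
    have h2 : μ {x | t < g x} ≤ M * ENNReal.ofReal (t ^ (-(1 / q))) := by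
      rw [Real.rpow_neg ht.le, ENNReal.ofReal_inv_of_pos (by positivity), ← div_eq_mul_inv,
        ENNReal.le_div_iff_mul_le (.inl (by simpa using Real.rpow_pos_of_pos ht _))
          (.inl ENNReal.ofReal_ne_top), mul_comm]
      exact h1
    refine (ENNReal.rpow_le_rpow h2 (by linarith)).trans_eq ?_
    rw [ENNReal.mul_rpow_of_nonneg _ _ (by linarith), ENNReal.ofReal_rpow_of_pos (by positivity),
      ← Real.rpow_mul ht.le]
    ring_nf
  have hpow : ∀ T : ℝ, ∫⁻ t in Ioo 0 T, ENNReal.ofReal (t ^ (-(q - 1) / q)) ≤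
      ENNReal.ofReal q * ENNReal.ofReal T ^ (1 / q) := by
    intro T
    rcases le_or_gt T 0 with hT | hT
    · simp [Ioo_eq_empty (not_lt.2 hT)]
    have hexp : -(q - 1) / q = 1 / q - 1 := by field_simp; ring
    have hint : IntervalIntegrable (fun t : ℝ => t ^ (-(q - 1) / q)) volume 0 T := by
      apply intervalIntegral.intervalIntegrable_rpow'
      rw [hexp]; linarith [show 0 < 1 / q by positivity]
    rw [setLIntegral_congr Ioo_ae_eq_Ioc, ← ofReal_integral_eq_lintegral_ofReal hint.1
      ((ae_restrict_iff' measurableSet_Ioc).2 (.of_forall fun t ht => Real.rpow_nonneg ht.1.le _)),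
      ← intervalIntegral.integral_of_le hT.le, hexp, integral_rpow
      (.inl (by linarith [show 0 < 1 / q by positivity])), sub_add_cancel,
      Real.zero_rpow (by positivity), ENNReal.ofReal_rpow_of_pos hT, ← ENNReal.ofReal_mul hq0.le]
    apply le_of_eq
    congr 1
    field_simp
    ring
  rw [lintegral_distribution_rpow hg hq]
  calc ∫⁻ x, ∫⁻ t in Ioo 0 (g x), μ {y | t < g y} ^ (q - 1) ∂volume ∂μ
      ≤ ∫⁻ x, M ^ (q - 1) * (ENNReal.ofReal q * ENNReal.ofReal (g x) ^ (1 / q)) ∂μ := by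
        refine lintegral_mono fun x => ?_
        refine (setLIntegral_mono' measurableSet_Ioo fun t ht => hcheb t ht.1).trans ?_
        rw [lintegral_const_mul _ (by fun_prop)]
        gcongr
        exact hpow _
    _ = M ^ (q - 1) * (ENNReal.ofReal q * M) := by
        rw [lintegral_const_mul _ (by fun_prop), lintegral_const_mul _ (by fun_prop)]
    _ < ∞ := by
        have : 0 ≤ q - 1 := by linarith
        finiteness

/-- Writing `m` for the distribution function of `g` and `N = ∫ m ^ q`, Hölder's inequality on
`(0, g x)` for each `x` gives `N ≤ ∫ g ^ (1 / q) N ^ (1 - 1 / q)`. -/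
theorem lintegral_distribution_rpow_le [SFinite μ] (hg : Measurable g) (hq : 1 < q)
    (hM : ∫⁻ x, ENNReal.ofReal (g x) ^ (1 / q) ∂μ ≠ ∞) :
    ∫⁻ t in Ioi 0, μ {x | t < g x} ^ q ≤ (∫⁻ x, ENNReal.ofReal (g x) ^ (1 / q) ∂μ) ^ q := by
  have hNfin := (lintegral_distribution_rpow_lt_top hg hq hM).ne
  set N := ∫⁻ t in Ioi 0, μ {x | t < g x} ^ q
  set M := ∫⁻ x, ENNReal.ofReal (g x) ^ (1 / q) ∂μ
  have hq0 : 0 < q := by linarith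
  have hle : N ≤ M * N ^ (1 - 1 / q) := by
    calc N = ∫⁻ x, ∫⁻ t in Ioo 0 (g x), μ {y | t < g y} ^ (q - 1) ∂volume ∂μ :=
          lintegral_distribution_rpow hg hq
      _ ≤ ∫⁻ x, ENNReal.ofReal (g x) ^ (1 / q) * N ^ (1 - 1 / q) ∂μ := by
          refine lintegral_mono fun x => (setLIntegral_distribution_rpow_le μ g hq (g x)).trans ?_
          have : 0 ≤ 1 - 1 / q := by rw [sub_nonneg, div_le_one hq0]; exact hq.le
          gcongr
          exact lintegral_mono_set Ioo_subset_Ioi_self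
      _ = M * N ^ (1 - 1 / q) := by rw [lintegral_mul_const _ (by fun_prop)]
  rcases eq_or_ne N 0 with h0 | h0
  · rw [h0]; exact zero_le
  have h1 : N ^ (1 / q) ≤ M := by
    have h2 : N = N ^ (1 / q) * N ^ (1 - 1 / q) := by
      rw [← ENNReal.rpow_add _ _ h0 hNfin, add_sub_cancel, ENNReal.rpow_one]
    have h3 : N ^ (1 - 1 / q) ≠ 0 := by simp [ENNReal.rpow_eq_zero_iff, h0, hNfin]
    have h4 : N ^ (1 - 1 / q) ≠ ∞ := by simp [ENNReal.rpow_eq_top_iff, h0, hNfin]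
    nth_rw 1 [h2] at hle
    exact (ENNReal.mul_le_mul_iff_left h3 h4).1 hle
  calc N = (N ^ (1 / q)) ^ q := by
        rw [← ENNReal.rpow_mul, one_div_mul_cancel hq0.ne', ENNReal.rpow_one]
    _ ≤ M ^ q := ENNReal.rpow_le_rpow h1 hq0.le

/-- In the equality case, `∫ m ^ q` over `(0, g x)` is the whole integral for almost every `x` with
`g x > 0`, so that `g ≤ g x` almost everywhere: `g` takes only one positive value. -/
theorem exists_ae_eq_indicator_of_lintegral_distribution_eq [SFinite μ] (hg : Measurable g)
    (hg0 : ∀ x, 0 ≤ g x) (hq : 1 < q) (hM : ∫⁻ x, ENNReal.ofReal (g x) ^ (1 / q) ∂μ ≠ ∞)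
    (heq : ∫⁻ t in Ioi 0, μ {x | t < g x} ^ q = (∫⁻ x, ENNReal.ofReal (g x) ^ (1 / q) ∂μ) ^ q) :
    ∃ c : ℝ, 0 ≤ c ∧ g =ᵐ[μ] {x | 0 < g x}.indicator fun _ => c := by
  have hNfin := (lintegral_distribution_rpow_lt_top hg hq hM).ne
  set N := ∫⁻ t in Ioi 0, μ {x | t < g x} ^ q
  set M := ∫⁻ x, ENNReal.ofReal (g x) ^ (1 / q) ∂μ
  have hq0 : 0 < q := by linarith
  have he : 0 < 1 - 1 / q := by rw [sub_pos, div_lt_one hq0]; exact hq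
  have hMN : M * N ^ (1 - 1 / q) = N := by
    rw [heq, ← ENNReal.rpow_mul]
    nth_rw 1 [← ENNReal.rpow_one M]
    rw [← ENNReal.rpow_add_of_nonneg _ _ zero_le_one (by positivity)]
    congr 1
    field_simp
    ring
  have hae : ∀ᵐ x ∂μ, 0 < g x → ∫⁻ t in Ioo 0 (g x), μ {y | t < g y} ^ q = N := by
    have h1 : (fun x => ∫⁻ t in Ioo 0 (g x), μ {y | t < g y} ^ (q - 1)) =ᵐ[μ]
        fun x => ENNReal.ofReal (g x) ^ (1 / q) * N ^ (1 - 1 / q) := by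
      refine ae_eq_of_ae_le_of_lintegral_le (.of_forall fun x => ?_) ?_ (by fun_prop) ?_
      · exact (setLIntegral_distribution_rpow_le μ g hq (g x)).trans (mul_le_mul' le_rfl
          (ENNReal.rpow_le_rpow (lintegral_mono_set Ioo_subset_Ioi_self) he.le))
      · rw [← lintegral_distribution_rpow hg hq]
        exact hNfin
      · rw [lintegral_mul_const _ (by fun_prop), hMN, ← lintegral_distribution_rpow hg hq]
    filter_upwards [h1] with x hx hpos
    refine le_antisymm (lintegral_mono_set Ioo_subset_Ioi_self) ?_
    have h2 := hx ▸ setLIntegral_distribution_rpow_le μ g hq (g x)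
    have h3 : ENNReal.ofReal (g x) ^ (1 / q) ≠ 0 := by
      simp [ENNReal.rpow_eq_zero_iff, hpos, hq0.not_gt]
    have h4 : ENNReal.ofReal (g x) ^ (1 / q) ≠ ∞ := by
      simp [ENNReal.rpow_eq_top_iff, hq0.not_gt]
    exact (ENNReal.rpow_le_rpow_iff he).1 ((ENNReal.mul_le_mul_iff_right h3 h4).1 h2)
  have hnull : ∀ T : ℝ, 0 < T → ∫⁻ t in Ioo 0 T, μ {y | t < g y} ^ q = N →
      ∀ t, T < t → μ {y | t < g y} = 0 := by
    intro T hT hTN t ht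
    have h1 : ∫⁻ s in Ioo T t, μ {y | s < g y} ^ q = 0 := by
      have hdisj : Disjoint (Ioo 0 T) (Ioo T t) := by
        rw [Set.disjoint_left]
        exact fun s h1 h2 => lt_asymm h1.2 h2.1
      have h2 := lintegral_union (μ := volume) (f := fun s => μ {y | s < g y} ^ q)
        measurableSet_Ioo hdisj
      have h3 : ∫⁻ s in Ioo 0 T ∪ Ioo T t, μ {y | s < g y} ^ q ≤ N := lintegral_mono_set
        (union_subset Ioo_subset_Ioi_self fun s hs => hT.trans hs.1)
      rw [h2, hTN] at h3
      exact le_zero_iff.1 ((ENNReal.add_le_add_iff_left hNfin).1 (h3.trans_eq (add_zero N).symm))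
    by_contra hne
    have h2 : ∫⁻ _ in Ioo T t, μ {y | t < g y} ^ q ≤ 0 := h1 ▸ setLIntegral_mono'
      measurableSet_Ioo fun s hs =>
        ENNReal.rpow_le_rpow (antitone_measure_setOf_lt μ g hs.2.le) hq0.le
    rw [setLIntegral_const, le_zero_iff, mul_eq_zero, Real.volume_Ioo, ENNReal.ofReal_eq_zero,
      ENNReal.rpow_eq_zero_iff_of_pos hq0] at h2
    rcases h2 with h2 | h2
    · exact hne h2
    · linarith
  -- the essential supremum of `g`
  set c := sInf {T : ℝ | 0 ≤ T ∧ ∀ t, T < t → μ {y | t < g y} = 0}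
  by_cases hne : {T : ℝ | 0 ≤ T ∧ ∀ t, T < t → μ {y | t < g y} = 0}.Nonempty
  · have hbdd : BddBelow {T : ℝ | 0 ≤ T ∧ ∀ t, T < t → μ {y | t < g y} = 0} :=
      ⟨0, fun T hT => hT.1⟩
    have hc0 : 0 ≤ c := le_csInf hne fun T hT => hT.1
    have hcnull : ∀ᵐ x ∂μ, g x ≤ c := by
      have h1 : ∀ k : ℕ, ∀ᵐ x ∂μ, g x ≤ c + 1 / (k + 1) := by
        intro k
        obtain ⟨T, hT, hTc⟩ := exists_lt_of_csInf_lt hne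
          (show c < c + 1 / ((k : ℝ) + 1) from lt_add_of_pos_right _ Nat.one_div_pos_of_nat)
        filter_upwards [measure_eq_zero_iff_ae_notMem.1 (hT.2 _ hTc)] with x hx
        exact not_lt.1 hx
      filter_upwards [ae_all_iff.2 h1] with x hx
      exact le_of_forall_pos_le_add fun ε hε => by
        obtain ⟨k, hk⟩ := exists_nat_one_div_lt hε
        exact (hx k).trans (by linarith)
    refine ⟨c, hc0, ?_⟩
    filter_upwards [hae, hcnull] with x hx hxc
    by_cases hpos : 0 < g x
    · rw [indicator_of_mem (show x ∈ {x | 0 < g x} from hpos)]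
      exact le_antisymm hxc (csInf_le hbdd ⟨hpos.le, hnull _ hpos (hx hpos)⟩)
    · rw [indicator_of_notMem (show x ∉ {x | 0 < g x} from hpos)]
      exact le_antisymm (not_lt.1 hpos) (hg0 x)
  · refine ⟨0, le_rfl, ?_⟩
    filter_upwards [hae] with x hx
    have hpos : ¬ 0 < g x := fun hpos => hne ⟨g x, hpos.le, hnull _ hpos (hx hpos)⟩
    rw [indicator_of_notMem (show x ∉ {x | 0 < g x} from hpos)]
    exact le_antisymm (not_lt.1 hpos) (hg0 x)

end DistributionFunction

/-! ### Layer cake decomposition of the energy -/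

theorem chordEnergy_congr {n : ℕ} {α : ℝ} {f g : EuclideanSpace ℝ (Fin n) → ℝ}
    (h : f =ᵐ[volume] g) : chordEnergy n α f = chordEnergy n α g := by
  refine lintegral_congr_ae ?_
  filter_upwards [h] with y hy
  refine lintegral_congr_ae ?_
  filter_upwards [h] with x hx
  rw [hx, hy]

theorem ofReal_min_eq_lintegral (a b : ℝ) :
    ENNReal.ofReal (min a b) =
      ∫⁻ t in Ioi (0 : ℝ), (Iio a).indicator 1 t * (Iio b).indicator 1 t := by
  classical
  have h : ∀ t : ℝ, (Iio a).indicator (1 : ℝ → ℝ≥0∞) t * (Iio b).indicator 1 t =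
      (Iio (min a b)).indicator 1 t := by
    intro t
    simp only [indicator_apply, mem_Iio, lt_min_iff, ite_and, Pi.one_apply, mul_ite, mul_one,
      mul_zero]
    split_ifs <;> rfl
  simp only [h]
  rw [lintegral_indicator_one measurableSet_Iio, Measure.restrict_apply measurableSet_Iio,
    inter_comm, Ioi_inter_Iio, Real.volume_Ioo, sub_zero]

theorem chordEnergy_eq_lintegral_rieszEnergy {n : ℕ} {α : ℝ} {g : EuclideanSpace ℝ (Fin n) → ℝ}
    (hg : Measurable g) :
    chordEnergy n α g = ∫⁻ t in Ioi 0, rieszEnergy ((n : ℝ) - α) {x | t < g x} := by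
  have h1 := measurable_indicator_setOf_lt hg
  have hE : ∀ t : ℝ, rieszEnergy ((n : ℝ) - α) {x | t < g x} =
      ∫⁻ y, ∫⁻ x, {x | t < g x}.indicator 1 y *
        ({x | t < g x}.indicator 1 x * rieszKernel ((n : ℝ) - α) y x) := fun t =>
    rieszEnergy_eq_lintegral_indicator _ (measurableSet_lt measurable_const hg)
  have h2 : Measurable fun p : (ℝ × EuclideanSpace ℝ (Fin n)) × EuclideanSpace ℝ (Fin n) =>
      {x | p.1.1 < g x}.indicator (1 : EuclideanSpace ℝ (Fin n) → ℝ≥0∞) p.1.2 *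
        ({x | p.1.1 < g x}.indicator 1 p.2 * rieszKernel ((n : ℝ) - α) p.1.2 p.2) :=
    (h1.comp measurable_fst).mul ((h1.comp ((measurable_fst.comp measurable_fst).prodMk
      measurable_snd)).mul (by fun_prop))
  simp only [hE]
  rw [lintegral_lintegral_swap h2.lintegral_prod_right'.aemeasurable, chordEnergy]
  refine lintegral_congr fun y => ?_
  have h3 : Measurable (Function.uncurry fun (t : ℝ) (x : EuclideanSpace ℝ (Fin n)) =>
      {x | t < g x}.indicator (1 : EuclideanSpace ℝ (Fin n) → ℝ≥0∞) y *
        ({x | t < g x}.indicator 1 x * rieszKernel ((n : ℝ) - α) y x)) :=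
    h2.comp (f := fun p : ℝ × EuclideanSpace ℝ (Fin n) => ((p.1, y), p.2)) (by fun_prop)
  rw [lintegral_lintegral_swap h3.aemeasurable]
  refine lintegral_congr fun x => ?_
  have h4 : ∀ t : ℝ, {x | t < g x}.indicator (1 : EuclideanSpace ℝ (Fin n) → ℝ≥0∞) y *
      ({x | t < g x}.indicator 1 x * rieszKernel ((n : ℝ) - α) y x) =
      (Iio (g x)).indicator 1 t * (Iio (g y)).indicator 1 t * rieszKernel ((n : ℝ) - α) y x := by
    intro t
    classical
    simp only [indicator_apply, mem_ofPred_eq, mem_Iio, Pi.one_apply]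
    ring
  simp only [h4]
  rw [lintegral_mul_const _ (by
    exact (measurable_one.indicator measurableSet_Iio).mul
      (measurable_one.indicator measurableSet_Iio)), ← ofReal_min_eq_lintegral, rieszKernel_comm,
    rieszKernel, ofReal_norm, div_eq_mul_inv]

theorem chordEnergy_indicator_const {n : ℕ} {α c : ℝ} (hc : 0 ≤ c)
    {A : Set (EuclideanSpace ℝ (Fin n))} (hA : MeasurableSet A) :
    chordEnergy n α (A.indicator fun _ => c) =
      ENNReal.ofReal c * rieszEnergy ((n : ℝ) - α) A := by
  classical
  rw [chordEnergy, rieszEnergy_eq_lintegral_indicator _ hA,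
    ← lintegral_const_mul' _ _ ENNReal.ofReal_ne_top]
  refine lintegral_congr fun y => ?_
  rw [← lintegral_const_mul' _ _ ENNReal.ofReal_ne_top]
  refine lintegral_congr fun x => ?_
  rw [rieszKernel_comm, rieszKernel, ofReal_norm, div_eq_mul_inv]
  by_cases hx : x ∈ A <;> by_cases hy : y ∈ A <;> simp [hx, hy, hc]

/-! ### The sharp inequality -/

/-- The Riesz rearrangement inequality for the energy of a set, in isoperimetric form. -/
theorem rieszEnergy_le_volume_rpow {n : ℕ} {α : ℝ} (hα : 0 < α) (hαn : α < n)
    {A : Set (EuclideanSpace ℝ (Fin n))} (hA : MeasurableSet A) (hfin : volume A ≠ ∞) :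
    rieszEnergy ((n : ℝ) - α) A ≤
        ENNReal.ofReal (chordSobolevConst n α) * volume A ^ (((n : ℝ) + α) / n) ∧
      (rieszEnergy ((n : ℝ) - α) A =
        ENNReal.ofReal (chordSobolevConst n α) * volume A ^ (((n : ℝ) + α) / n) →
        ∃ (c : EuclideanSpace ℝ (Fin n)) (r : ℝ), A =ᵐ[volume] closedBall c r) := by
  have hn : n ≠ 0 := by rintro rfl; norm_num at hαn; linarith
  have : Nontrivial (EuclideanSpace ℝ (Fin n)) :=
    Module.nontrivial_of_finrank_pos (R := ℝ) (by simpa using Nat.pos_of_ne_zero hn)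
  have hβ : 0 < (n : ℝ) - α := sub_pos.2 hαn
  have hβd : (n : ℝ) - α < Module.finrank ℝ (EuclideanSpace ℝ (Fin n)) := by
    rw [finrank_euclideanSpace_fin]; linarith
  obtain ⟨r, hr, hv⟩ := exists_volume_closedBall_eq (E := EuclideanSpace ℝ (Fin n)) hfin
  rw [← hv, ← rieszEnergy_closedBall hn hα 0 hr]
  refine ⟨rieszEnergy_le_closedBall hβ hβd hA hv.symm, fun h => ?_⟩
  obtain ⟨c, hc⟩ := exists_ae_eq_closedBall_of_rieszEnergy_eq hβ hβd hA hv.symm h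
  exact ⟨c, r, hc⟩

theorem eLpNorm_eq_lintegral_ofReal_rpow {n : ℕ} {α : ℝ} (hα : 0 < α) (hn : 0 < (n : ℝ))
    {g : EuclideanSpace ℝ (Fin n) → ℝ} (hg : ∀ x, 0 ≤ g x) :
    eLpNorm g (ENNReal.ofReal (n / (n + α))) volume =
      (∫⁻ x, ENNReal.ofReal (g x) ^ (1 / (((n : ℝ) + α) / n))) ^ (((n : ℝ) + α) / n) := by
  have hp : 0 < (n : ℝ) / (n + α) := by positivity
  rw [eLpNorm_eq_lintegral_rpow_enorm_toReal (by simpa using hp) ENNReal.ofReal_ne_top,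
    ENNReal.toReal_ofReal hp.le, one_div_div, one_div_div]
  congr 1
  refine lintegral_congr fun x => ?_
  rw [Real.enorm_eq_ofReal (hg x)]

theorem eLpNorm_indicator_const_eq {n : ℕ} {α c : ℝ} (hα : 0 < α) (hn : 0 < (n : ℝ)) (hc : 0 ≤ c)
    {A : Set (EuclideanSpace ℝ (Fin n))} (hA : MeasurableSet A) :
    eLpNorm (A.indicator fun _ => c) (ENNReal.ofReal (n / (n + α))) volume =
      ENNReal.ofReal c * volume A ^ (((n : ℝ) + α) / n) := by
  have hp : 0 < (n : ℝ) / (n + α) := by positivity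
  rw [eLpNorm_indicator_const hA (by simpa using hp) ENNReal.ofReal_ne_top,
    ENNReal.toReal_ofReal hp.le, one_div_div, Real.enorm_eq_ofReal hc]

/-- Multiples of indicator functions of balls are extremal. -/
theorem chordEnergy_indicator_closedBall {n : ℕ} {α c r : ℝ} (hα : 0 < α) (hn : n ≠ 0) (hc : 0 ≤ c)
    (hr : 0 ≤ r) (x₀ : EuclideanSpace ℝ (Fin n)) :
    chordEnergy n α ((closedBall x₀ r).indicator fun _ => c) =
      ENNReal.ofReal (chordSobolevConst n α) *
        eLpNorm ((closedBall x₀ r).indicator fun _ => c) (ENNReal.ofReal (n / (n + α))) volume := by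
  rw [chordEnergy_indicator_const hc measurableSet_closedBall,
    eLpNorm_indicator_const_eq hα (by exact_mod_cast Nat.pos_of_ne_zero hn) hc
      measurableSet_closedBall, rieszEnergy_closedBall hn hα x₀ hr]
  ring

/-- The inequality and its equality case for a representative that is measurable and non-negative
everywhere. -/
theorem chordEnergy_le {n : ℕ} {α : ℝ} (hα : 0 < α) (hαn : α < n)
    {g : EuclideanSpace ℝ (Fin n) → ℝ} (hg : Measurable g) (hg0 : ∀ x, 0 ≤ g x)
    (hLp : eLpNorm g (ENNReal.ofReal (n / (n + α))) volume ≠ ∞) :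
    chordEnergy n α g ≤ ENNReal.ofReal (chordSobolevConst n α) *
        eLpNorm g (ENNReal.ofReal (n / (n + α))) volume ∧
      (chordEnergy n α g = ENNReal.ofReal (chordSobolevConst n α) *
          eLpNorm g (ENNReal.ofReal (n / (n + α))) volume →
        ∃ (c : ℝ) (x₀ : EuclideanSpace ℝ (Fin n)) (r : ℝ), 0 ≤ c ∧ 0 < r ∧
          g =ᵐ[volume] (closedBall x₀ r).indicator fun _ => c) := by
  have hn' : 0 < (n : ℝ) := hα.trans hαn
  have hn : n ≠ 0 := by rintro rfl; simp at hn'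
  have hσ := chordSobolevConst_pos hn hα
  have hσ0 : ENNReal.ofReal (chordSobolevConst n α) ≠ 0 := by simpa using hσ
  have hq : 1 < ((n : ℝ) + α) / n := by rw [one_lt_div hn']; linarith
  have hq0 : 0 < ((n : ℝ) + α) / n := by linarith
  have hnorm := eLpNorm_eq_lintegral_ofReal_rpow hα hn' hg0
  have hM : ∫⁻ x, ENNReal.ofReal (g x) ^ (1 / (((n : ℝ) + α) / n)) ≠ ∞ := by
    rw [hnorm] at hLp
    exact fun h => hLp (by rw [h, ENNReal.top_rpow_of_pos hq0])
  have hN := lintegral_distribution_rpow_le hg hq hM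
  have hlevel : chordEnergy n α g ≤ ENNReal.ofReal (chordSobolevConst n α) *
      ∫⁻ t in Ioi 0, volume {x | t < g x} ^ (((n : ℝ) + α) / n) := by
    rw [chordEnergy_eq_lintegral_rieszEnergy hg, ← lintegral_const_mul' _ _ ENNReal.ofReal_ne_top]
    refine lintegral_mono fun t => ?_
    by_cases ht : volume {x | t < g x} = ∞
    · rw [ht, ENNReal.top_rpow_of_pos hq0, ENNReal.mul_top hσ0]
      exact le_top
    · exact (rieszEnergy_le_volume_rpow hα hαn (measurableSet_lt measurable_const hg) ht).1
  have hle := hlevel.trans (mul_le_mul' le_rfl hN)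
  refine ⟨hnorm ▸ hle, fun heq => ?_⟩
  have heqN : ∫⁻ t in Ioi 0, volume {x | t < g x} ^ (((n : ℝ) + α) / n) =
      (∫⁻ x, ENNReal.ofReal (g x) ^ (1 / (((n : ℝ) + α) / n))) ^ (((n : ℝ) + α) / n) := by
    refine le_antisymm hN ?_
    rw [heq, hnorm] at hlevel
    exact (ENNReal.mul_le_mul_iff_right hσ0 ENNReal.ofReal_ne_top).1 hlevel
  obtain ⟨c, hc, hgc⟩ := exists_ae_eq_indicator_of_lintegral_distribution_eq hg hg0 hq hM heqN
  have hA : MeasurableSet {x | 0 < g x} := measurableSet_lt measurable_const hg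
  by_cases hzero : c = 0 ∨ volume {x | 0 < g x} = 0
  · refine ⟨0, 0, 1, le_rfl, one_pos, ?_⟩
    rcases hzero with rfl | h0
    · simpa using hgc
    · filter_upwards [measure_eq_zero_iff_ae_notMem.1 h0] with x hx
      rw [indicator_zero]
      exact le_antisymm (not_lt.1 hx) (hg0 x)
  push Not at hzero
  have hcpos : ENNReal.ofReal c ≠ 0 := by simpa using lt_of_le_of_ne hc (Ne.symm hzero.1)
  rw [chordEnergy_congr hgc, eLpNorm_congr_ae hgc, chordEnergy_indicator_const hc hA,
    eLpNorm_indicator_const_eq hα hn' hc hA, mul_left_comm,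
    ENNReal.mul_right_inj hcpos ENNReal.ofReal_ne_top] at heq
  have hfin : volume {x | 0 < g x} ≠ ∞ := by
    intro h
    rw [eLpNorm_congr_ae hgc, eLpNorm_indicator_const_eq hα hn' hc hA, h,
      ENNReal.top_rpow_of_pos hq0, ENNReal.mul_top hcpos] at hLp
    exact hLp rfl
  obtain ⟨x₀, r, hball⟩ := (rieszEnergy_le_volume_rpow hα hαn hA hfin).2 heq
  refine ⟨c, x₀, r, hc, ?_, hgc.trans (indicator_ae_eq_of_ae_eq_set hball)⟩
  by_contra hr
  apply hzero.2
  rw [measure_congr hball]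
  refine measure_mono_null (closedBall_subset_closedBall (not_lt.1 hr)) ?_
  have : Nontrivial (EuclideanSpace ℝ (Fin n)) :=
    Module.nontrivial_of_finrank_pos (R := ℝ) (by simpa using Nat.pos_of_ne_zero hn)
  simp

end

theorem theorem1 (n : ℕ) (α : ℝ) (hα : 0 < α) (hαn : α < n) :
    -- the two expressions for the constant agree
    (chordSobolevConst n α =
      n * (chordPowerIntegral n (α + 1) (Metric.closedBall 0 1)).toReal /
        (|α| * (α + 1) *
          (volume (Metric.closedBall (0 : EuclideanSpace ℝ (Fin n)) 1)).toReal ^ (α / n))) ∧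
    -- the inequality and its equality cases
    (∀ f : EuclideanSpace ℝ (Fin n) → ℝ,
      MemLp f (ENNReal.ofReal (n / (n + α))) volume → 0 ≤ᵐ[volume] f →
        chordEnergy n α f ≤
            ENNReal.ofReal (chordSobolevConst n α) *
              eLpNorm f (ENNReal.ofReal (n / (n + α))) volume ∧
        (chordEnergy n α f =
            ENNReal.ofReal (chordSobolevConst n α) *
              eLpNorm f (ENNReal.ofReal (n / (n + α))) volume ↔
          ∃ (c : ℝ) (x₀ : EuclideanSpace ℝ (Fin n)) (r : ℝ), 0 ≤ c ∧ 0 < r ∧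
            f =ᵐ[volume] (Metric.closedBall x₀ r).indicator (fun _ => c))) ∧
    -- the constant is sharp
    (∀ C : ℝ,
      (∀ f : EuclideanSpace ℝ (Fin n) → ℝ,
        MemLp f (ENNReal.ofReal (n / (n + α))) volume → 0 ≤ᵐ[volume] f →
          chordEnergy n α f ≤
            ENNReal.ofReal C * eLpNorm f (ENNReal.ofReal (n / (n + α))) volume) →
      chordSobolevConst n α ≤ C) := by
  have hn' : 0 < (n : ℝ) := hα.trans hαn
  have hn : n ≠ 0 := by rintro rfl; simp at hn'
  have hW := ballChordConst_pos (Nat.one_le_iff_ne_zero.2 hn) hα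
  have hσ := chordSobolevConst_pos hn hα
  refine ⟨?_, fun f hf hf0 => ?_, fun C hC => ?_⟩
  · rw [chordPowerIntegral_unitBall hn hα, ENNReal.toReal_ofReal hW.le]
    exact chordSobolevConst_eq hn hα
  · obtain ⟨g, hg, hg0, hfg⟩ : ∃ g : EuclideanSpace ℝ (Fin n) → ℝ,
        Measurable g ∧ (∀ x, 0 ≤ g x) ∧ f =ᵐ[volume] g := by
      refine ⟨fun x => max (hf.1.mk f x) 0, hf.1.stronglyMeasurable_mk.measurable.max
        measurable_const, fun x => le_max_right _ _, ?_⟩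
      filter_upwards [hf.1.ae_eq_mk, hf0] with x hx hx0
      rw [← hx]
      exact (max_eq_left hx0).symm
    have hLp : eLpNorm g (ENNReal.ofReal (n / (n + α))) volume ≠ ∞ :=
      eLpNorm_congr_ae hfg ▸ hf.2.ne
    obtain ⟨hle, heq⟩ := chordEnergy_le hα hαn hg hg0 hLp
    rw [chordEnergy_congr hfg, eLpNorm_congr_ae hfg]
    refine ⟨hle, fun h => ?_, ?_⟩
    · obtain ⟨c, x₀, r, hc, hr, hgc⟩ := heq h
      exact ⟨c, x₀, r, hc, hr, hfg.trans hgc⟩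
    · rintro ⟨c, x₀, r, hc, hr, hfc⟩
      have hgc := hfg.symm.trans hfc
      rw [chordEnergy_congr hgc, eLpNorm_congr_ae hgc]
      exact chordEnergy_indicator_closedBall hα hn hc hr.le x₀
  · have hB : MeasurableSet (Metric.closedBall (0 : EuclideanSpace ℝ (Fin n)) 1) :=
      measurableSet_closedBall
    have h := hC ((Metric.closedBall 0 1).indicator fun _ => 1)
      (memLp_indicator_const _ hB _ (.inr measure_closedBall_lt_top.ne))
      (.of_forall fun x => Set.indicator_nonneg (fun _ _ => zero_le_one) x)
    rw [chordEnergy_indicator_closedBall hα hn zero_le_one zero_le_one] at h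
    have hv0 : volume (Metric.closedBall (0 : EuclideanSpace ℝ (Fin n)) 1) ≠ 0 :=
      (Metric.measure_closedBall_pos _ _ one_pos).ne'
    have hv : volume (Metric.closedBall (0 : EuclideanSpace ℝ (Fin n)) 1) ≠ ∞ :=
      measure_closedBall_lt_top.ne
    rw [eLpNorm_indicator_const_eq hα hn' zero_le_one hB, ENNReal.ofReal_one, one_mul,
      ENNReal.mul_le_mul_iff_left (by simp [ENNReal.rpow_eq_zero_iff, hv0, hv])
        (by simp [ENNReal.rpow_eq_top_iff, hv0, hv])] at h
    by_contra! hlt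
    exact h.not_gt ((ENNReal.ofReal_lt_ofReal_iff hσ).2 hlt)
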